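/- **Setting.** Let $p,q\ge 1$, $N\ge 1$ and $0\le r\le p-1$ be integers. Let $R(x)=\sum_{l=0}^N R_lx^l$, $R_l\in\mathbb C^{p\times p}$, be a matrix polynomial with $$R_N=\begin{bmatrix}0_{(p-r)\times r}&I_{p-r}\\0_{r\times r}&0_{r\times(p-r)}\end{bmatrix},\qquad R_{N-1}=\begin{bmatrix}*&*\\I_r&*\end{bmatrix},$$ where $I_r$ occupies the last $r$ rows and the first $r$ columns; then $\deg\det R=Np-r$. Let $\mu=(\mu_{b,a})$ be a $q\times p$ matrix of complex (for instance, positive) Borel measures with finite moments, supported on a closed set $\Delta\subseteq\mathbb R$ that contains no zero of $\det R$. For $m\ge1$ let $X_{[m]}(x)=[I_m,\,xI_m,\,x^2I_m,\dots]^\top$. Orthogonality is said to exist for a $q\times p$ matrix $\nu$ of measures (or generalized functions) if there are a lower unitriangular matrix $S$ and an upper triangular matrix $U$ with nonzero diagonal such that the rows $B_n=[B_n^{(1)},\dots,B_n^{(q)}]$ of $B=SX_{[q]}$ and the columns $A_n=[A^{(1)}_n,\dots,A^{(p)}_n]^\top$ of $A=X_{[p]}^\top U$ satisfy $\int B_n\,\mathrm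 d\nu\,A_m=\delta_{n,m}$ for all $n,m\ge0$ (equivalently, the moment matrix $\int X_{[q]}\,\mathrm d\nu\,X_{[p]}^\top=S^{-1}U^{-1}$ has an $LU$ factorization). Assume that orthogonality exists for $\mu$, with polynomials $B_n,A_n$. Let $x_1,\dots,x_M\in\mathbb C$ be the distinct zeros of $\det R$. For each $i$ let $v^L_{i,j;k}$ (rows) and $v^R_{i,j;k}$ (columns), $1\le j\le s_i$, $0\le k<\kappa_{i,j}$, be canonical sets of left and right Jordan chains of $R$ at $x_i$: $$\sum_{l=0}^k\tfrac1{l!}v^L_{i,j;k-l}R^{(l)}(x_i)=0,\qquad \sum_{l=0}^k\tfrac1{l!}R^{(l)}(x_i)v^R_{i,j;k-l}=0,$$ the $v^L_{i,j;0}$ ($1\le j\le s_i$) are linearly independent, so are the $v^R_{i,j;0}$, and $\sum_j\kappa_{i,j}$ is the multiplicity of $x_i$ as a zero of $\det R$. Let $\xi_{i,j,k}$ be column vector functions of size $q$, analytic at $x_i$ and otherwise arbitrary. The perturbed matrix of generalized measures is $$\mathrm d\check\mu(x)=\mathrm d\mu(x)R^{-1}(x)+\sum_{i=1}^M\sum_{j=1}^{s_i}\sum_{k=0}^{\kappa_{i,j}-1}\xi_{i,j,k}(x)\sum_{l=0}^k\frac{(-1)^l}{l!}v^L_{i,j;k-l}\,\delta^{(l)}(x-x_i),$$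 so that $\mathrm d\check\mu\,R=\mathrm d\mu$; here $\int f(x)\,(-1)^l\delta^{(l)}(x-x_i)\,\mathrm dx=f^{(l)}(x_i)$. For $n\ge 0$ put $D_n(z)=\int_\Delta B_n(t)\frac{\mathrm d\mu(t)}{z-t}$ and, for each $i$, $$w_{n,i}(z)=\sum_{j=1}^{s_i}\sum_{k=0}^{\kappa_{i,j}-1}\sum_{l=0}^k\frac1{l!}\frac{\mathrm d^l}{\mathrm dt^l}\left[\frac{B_n(t)\xi_{i,j,k}(t)}{z-t}\right]_{t=x_i}v^L_{i,j;k-l}R(z).$$ Let $\mathbb D_n-\mathbb W_n$ be the row vector of length $Np-r$ with entries, indexed lexicographically by $(i,j,k)$ with $0\le k<\kappa_{i,j}$, $$\sum_{l=0}^k\frac1{l!}D_n^{(l)}(x_i)v^R_{i,j;k-l}-\lim_{z\to x_i}\sum_{l=0}^k\frac1{l!}w_{n,i}^{(l)}(z)v^R_{i,j;k-l},$$ and for $n\ge Np-r-1$ let $\tau_n$ be the determinant of the $(Np-r)\times(Np-r)$ matrix with rows $\mathbb D_m-\mathbb W_m$, $m=n-Np+r+1,\dots,n$. **Theorem.** Suppose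 that $\tau_n\ne0$ for all $n\ge Np-r-1$, and that there exist $Np-r$ vector polynomials $\check B_n=[\check B^{(1)}_n,\dots,\check B^{(q)}_n]$, $n\in\{0,\dots,Np-r-1\}$, such that $\check B_n$ is the $n$-th row of (a lower unitriangular matrix) $\cdot X_{[q]}$ and $$\int\sum_{b=1}^q\check B_n^{(b)}(x)\,\mathrm d\check\mu_{b,a}(x)\,x^l=0,\qquad a\in\{1,\dots,p\},\quad l\in\Big\{0,\dots,\Big\lceil\frac{n-a+1}{p}\Big\rceil-1\Big\}.$$ Then orthogonality exists for $\check\mu$. -/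

import Mathlib

open MeasureTheory Polynomial Filter Topology
open scoped Matrix Nat

namespace MixedMOP

noncomputable section

/-! ### Vector polynomials on the step line

Vector polynomials with `m` components are expanded in the step-line basis
`e_0, e_1, …, e_{m-1}, x e_0, …, x e_{m-1}, x^2 e_0, …` (the entries of the monomial
matrix `X_[m]`).  The `n`-th basis vector is `x^(n / m)` in component `n % m`. -/

/-- The coefficient of a vector polynomial at the `n`-th step-line monomial. -/
def stepCoeff {m : ℕ} [NeZero m] (P : Fin m → ℂ[X]) (n : ℕ) : ℂ :=
  (P (Fin.ofNat m n)).coeff (n / m)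

/-- `P` is a combination of the step-line monomials of index `0, …, n`, with coefficient `1`
at index `n`: a row of a lower unitriangular matrix times `X_[m]`. -/
def IsStepMonic {m : ℕ} [NeZero m] (P : Fin m → ℂ[X]) (n : ℕ) : Prop :=
  stepCoeff P n = 1 ∧ ∀ k, n < k → stepCoeff P k = 0

/-- `P` is a combination of the step-line monomials of index `0, …, n`, with nonzero coefficient
at index `n`: `X_[m]ᵀ` times a column of an upper triangular matrix with nonzero diagonal. -/
def HasStepDegree {m : ℕ} [NeZero m] (P : Fin m → ℂ[X]) (n : ℕ) : Prop :=
  stepCoeff P n ≠ 0 ∧ ∀ k, n < k → stepCoeff P k = 0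

/-! ### Mixed multiple orthogonality

A `q × p` matrix of measures (or of generalized functions) enters through the pairing
`(P, Q) ↦ ∑_{b,a} ∫ P_b dμ_{b,a} Q_a` of row vectors `P` with `q` polynomial entries and column
vectors `Q` with `p` polynomial entries. -/

/-- `B` and `A` are the mixed multiple orthogonal polynomials on the step line of the pairing `pair`,
with the normalization in which `B` is monic: `B = S X_[q]` with `S` lower unitriangular,
`A = X_[p]ᵀ U` with `U` upper triangular with nonzero diagonal, and `pair (B n) (A m) = δ_{n,m}`.
For the moment matrix `ℳ` of `pair` the last condition reads `S ℳ U = I`, so that such a pair is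
the same thing as an `LU` factorization `ℳ = S⁻¹ U⁻¹`. -/
structure IsBiorthogonal {p q : ℕ} [NeZero p] [NeZero q]
    (pair : (Fin q → ℂ[X]) → (Fin p → ℂ[X]) → ℂ)
    (B : ℕ → Fin q → ℂ[X]) (A : ℕ → Fin p → ℂ[X]) : Prop where
  monic_B : ∀ n, IsStepMonic (B n) n
  degree_A : ∀ n, HasStepDegree (A n) n
  biorthogonal : ∀ n m, pair (B n) (A m) = if n = m then 1 else 0

/-- Orthogonality exists for the pairing `pair`. -/
def OrthogonalityExists {p q : ℕ} [NeZero p] [NeZero q]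
    (pair : (Fin q → ℂ[X]) → (Fin p → ℂ[X]) → ℂ) : Prop :=
  ∃ (B : ℕ → Fin q → ℂ[X]) (A : ℕ → Fin p → ℂ[X]), IsBiorthogonal pair B A

/-- The integral of a complex function against a complex measure on the line. -/
def cintegral (μ : ComplexMeasure ℝ) (f : ℝ → ℂ) : ℂ :=
  VectorMeasure.integral μ f (ContinuousLinearMap.mul ℝ ℂ)

/-- The pairing `∑_{b,a} ∫ P_b dμ_{b,a} Q_a` of a matrix of measures. -/
def measurePairing {p q : ℕ} (μ : Fin q → Fin p → ComplexMeasure ℝ)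
    (P : Fin q → ℂ[X]) (Q : Fin p → ℂ[X]) : ℂ :=
  ∑ b, ∑ a, cintegral (μ b a) fun t => (P b).eval (t : ℂ) * (Q a).eval (t : ℂ)

/-! ### Matrix polynomials and Jordan chains -/

/-- The value at `z` of the `l`-th derivative of a matrix polynomial. -/
def evalDeriv {p : ℕ} (R : Matrix (Fin p) (Fin p) ℂ[X]) (l : ℕ) (z : ℂ) :
    Matrix (Fin p) (Fin p) ℂ :=
  R.map fun f => (derivative^[l] f).eval z

/-- `R = R_0 + R_1 x + ⋯ + R_N x^N` with leading and subleading coefficients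
`R_N = [0, I_{p-r}; 0, 0]` (with `r` zero columns and `r` zero rows) and `R_{N-1} = [*, *; I_r, *]`
(the identity block occupies the last `r` rows and the first `r` columns). -/
structure LeadingCondition {p : ℕ} (N r : ℕ) (R : Matrix (Fin p) (Fin p) ℂ[X]) : Prop where
  degree_le : ∀ a c, (R a c).natDegree ≤ N
  leading : ∀ a c : Fin p, (R a c).coeff N = if (c : ℕ) = a + r then 1 else 0
  subleading : ∀ a c : Fin p, p - r ≤ (a : ℕ) → (c : ℕ) < r →
    (R a c).coeff (N - 1) = if (a : ℕ) = (p - r) + c then 1 else 0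

/-- The eigenvalues `x_1, …, x_M` (the distinct zeros of `det R`) of a regular matrix polynomial
with, for every eigenvalue `x_i`, a canonical set of left and a canonical set of right Jordan
chains: `s_i` chains of lengths `κ_{i,1}, …, κ_{i,s_i}` which add up to the multiplicity of `x_i`
as a zero of `det R` and whose first vectors are linearly independent.  The value of `vL i j k` and
`vR i j k` matters only for `k < κ i j`. -/
structure CanonicalJordanData {p : ℕ} (R : Matrix (Fin p) (Fin p) ℂ[X]) where
  M : ℕ
  x : Fin M → ℂ
  x_injective : Function.Injective x
  det_eq_zero_iff : ∀ z, R.det.eval z = 0 ↔ ∃ i, x i = z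
  s : Fin M → ℕ
  κ : (i : Fin M) → Fin (s i) → ℕ
  κ_pos : ∀ i j, 0 < κ i j
  sum_κ : ∀ i, ∑ j, κ i j = R.det.rootMultiplicity (x i)
  vL : (i : Fin M) → Fin (s i) → ℕ → Fin p → ℂ
  vR : (i : Fin M) → Fin (s i) → ℕ → Fin p → ℂ
  left_chain : ∀ i j k, k < κ i j →
    ∑ l ∈ Finset.range (k + 1), (1 / (l ! : ℂ)) • (vL i j (k - l) ᵥ* evalDeriv R l (x i)) = 0
  right_chain : ∀ i j k, k < κ i j →
    ∑ l ∈ Finset.range (k + 1), (1 / (l ! : ℂ)) • (evalDeriv R l (x i) *ᵥ vR i j (k - l)) = 0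
  left_independent : ∀ i, LinearIndependent ℂ fun j => vL i j 0
  right_independent : ∀ i, LinearIndependent ℂ fun j => vR i j 0

namespace CanonicalJordanData

variable {p : ℕ} {R : Matrix (Fin p) (Fin p) ℂ[X]} (J : CanonicalJordanData R)

/-- The total number of Jordan vectors, which is the degree of `det R`. -/
def size : ℕ := ∑ i, ∑ j, J.κ i j

/-- The triples `(i, j, k)` with `k < κ i j`. -/
abbrev Index : Type := (i : Fin J.M) × (j : Fin (J.s i)) × Fin (J.κ i j)

/-- The enumeration of the triples `(i, j, k)` in lexicographic order. -/
def enum (c : Fin J.size) : J.Index :=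
  let u := (finSigmaFinEquiv (n := fun i => ∑ j, J.κ i j)).symm c
  ⟨u.1, finSigmaFinEquiv.symm u.2⟩

end CanonicalJordanData

/-! ### The Geronimus perturbation -/

section Geronimus

variable {p q : ℕ} (μ : Fin q → Fin p → ComplexMeasure ℝ) {R : Matrix (Fin p) (Fin p) ℂ[X]}
  (J : CanonicalJordanData R)
  (ξ : (i : Fin J.M) → Fin (J.s i) → ℕ → Fin q → ℂ → ℂ)

/-- The pairing `∫ P dμ̌ Q` of the perturbed matrix of (generalized) measures
`dμ̌ = dμ R⁻¹ + ∑_{i,j,k} ξ_{i,j,k} ∑_{l ≤ k} ((-1)^l / l!) v^L_{i,j;k-l} δ^{(l)}(x - x_i)`,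
which satisfies `dμ̌ R = dμ`.  As usual, `(-1)^l δ^{(l)}(x - x_i)` is the functional
`f ↦ f^{(l)}(x_i)`. -/
def geronimusPairing (P : Fin q → ℂ[X]) (Q : Fin p → ℂ[X]) : ℂ :=
  (∑ b, ∑ c, cintegral (μ b c) fun t =>
    (P b).eval (t : ℂ) * ∑ a, (evalDeriv R 0 (t : ℂ))⁻¹ c a * (Q a).eval (t : ℂ)) +
  ∑ i, ∑ j, ∑ k ∈ Finset.range (J.κ i j), ∑ l ∈ Finset.range (k + 1),
    (1 / (l ! : ℂ)) * iteratedDeriv l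
      (fun z => (∑ b, (P b).eval z * ξ i j k b z) *
        ∑ a, J.vL i j (k - l) a * (Q a).eval z) (J.x i)

/-- The Cauchy transform `D(z) = ∫ P(t) dμ(t) / (z - t)`, a row vector. -/
def cauchyD (P : Fin q → ℂ[X]) (z : ℂ) (a : Fin p) : ℂ :=
  ∑ b, cintegral (μ b a) fun t => (P b).eval (t : ℂ) / (z - (t : ℂ))

/-- The entry of `𝔻` at `(i, j, k)`: `∑_{l ≤ k} (1 / l!) D^{(l)}(x_i) v^R_{i,j;k-l}`. -/
def bbD (P : Fin q → ℂ[X]) (u : J.Index) : ℂ :=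
  ∑ l ∈ Finset.range (u.2.2.val + 1), (1 / (l ! : ℂ)) *
    ∑ a, iteratedDeriv l (fun z => cauchyD μ P z a) (J.x u.1) *
      J.vR u.1 u.2.1 (u.2.2 - l) a

/-- The row vector
`∫ ∑_{j,k,l} ((-1)^l / l!) P(t) ξ_{i,j,k}(t) v^L_{i,j;k-l} δ^{(l)}(t - x_i) R(z) / (z - t) dt`. -/
def massTransform (P : Fin q → ℂ[X]) (i : Fin J.M) (z : ℂ) : Fin p → ℂ :=
  ∑ j, ∑ k ∈ Finset.range (J.κ i j), ∑ l ∈ Finset.range (k + 1),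
    ((1 / (l ! : ℂ)) * iteratedDeriv l
      (fun t => (∑ b, (P b).eval t * ξ i j k b t) / (z - t)) (J.x i)) •
        (J.vL i j (k - l) ᵥ* evalDeriv R 0 z)

/-- The entry of `𝕎` at `(i, j, k)`: the limit as `z → x_i` of
`∑_{l ≤ k} (1 / l!) w^{(l)}(z) v^R_{i,j;k-l}`, with `w` the row vector `massTransform`. -/
def bbW (P : Fin q → ℂ[X]) (u : J.Index) : ℂ :=
  limUnder (𝓝[≠] (J.x u.1)) fun z =>
    ∑ l ∈ Finset.range (u.2.2.val + 1), (1 / (l ! : ℂ)) *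
      ∑ a, iteratedDeriv l (fun y => massTransform J ξ P u.1 y a) z *
        J.vR u.1 u.2.1 (u.2.2 - l) a

/-- The determinant `τ_n`, for `n ≥ J.size - 1`: its rows are the vectors `𝔻_m - 𝕎_m` of the
polynomials `B_m` with `m = n - J.size + 1, …, n`. -/
def tau (B : ℕ → Fin q → ℂ[X]) (n : ℕ) : ℂ :=
  (Matrix.of fun m c : Fin J.size =>
    bbD μ J (B (n + 1 - J.size + m)) (J.enum c) -
      bbW J ξ (B (n + 1 - J.size + m)) (J.enum c)).det

end Geronimus

end

end MixedMOP

/-! Write K = Np - r, L for the pairing of μ, G for the perturbed pairing and e_n for the step-line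
monomials. Two facts drive the proof: G(P, RQ) = L(P, Q), and R e_n is step-monic of index n + K.
The first holds because R⁻¹R = I on Δ and left Jordan chains annihilate R at the mass points. The
second is read off from R_N and R_{N-1}.

For n ≥ K one looks for P = B_n + Σ_{j<K} c_j B_{n-K+j}. Such a P is automatically G-orthogonal to R
e_i for i < n - K, and these columns together with e_0, …, e_{K-1} span all step degrees below n.
What remains is a K × K linear system with matrix G(B_m, e_c), n - K ≤ m < n. If G(P, e_n) vanished,
pairing with R e_{n-K} would give c_0 = 0, and a nontrivial combination of B_{n-K+1}, …, B_n would
be orthogonal to the first K monomials, so the next such matrix would be singular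
(`exists_orthogonal`). For n < K the polynomials are given, and a triangularity argument with the
first K rows gives G(P_n, e_n) ≠ 0 (`initial_ne_zero`). The dual family A is then obtained by
Gram–Schmidt.

The link with τ is the polynomial column y = R v / (x - x_i)^(k+1), with v a truncated right Jordan
chain. The entry of 𝔻 - 𝕎 is -G(B_m, y) (`bbD_sub_bbW_eq`): the Cauchy transform yields the part
with R⁻¹y = v / (x - x_i)^(k+1), and the limit in 𝕎 yields the mass at x_i. Masses at other points
do not see y, since there y is R times an analytic germ. As y has step degree below K, the matrix of
τ_n is the matrix G(B_m, e_c) times a coefficient matrix, so τ_n ≠ 0 makes the former invertible. -/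

namespace MixedMOP

noncomputable section

/-! ### Step-line expansions of vector polynomials -/

section StepLine

variable {m : ℕ} [NeZero m]

/-- The `n`-th step-line monomial. -/
def stepMonomial (m : ℕ) [NeZero m] (n : ℕ) : Fin m → ℂ[X] :=
  Pi.single (Fin.ofNat m n) (X ^ (n / m))

/-- `P` is a combination of the step-line monomials of index less than `n`. -/
def StepLT (P : Fin m → ℂ[X]) (n : ℕ) : Prop := ∀ k, n ≤ k → stepCoeff P k = 0

theorem stepCoeff_mul_add (P : Fin m → ℂ[X]) (l : ℕ) (a : Fin m) :
    stepCoeff P (l * m + a) = (P a).coeff l := by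
  have h1 : (l * m + (a : ℕ)) / m = l := by
    rw [mul_comm, Nat.mul_add_div (NeZero.pos m), Nat.div_eq_of_lt a.2, add_zero]
  have h2 : Fin.ofNat m (l * m + (a : ℕ)) = a := by
    ext
    simp [Fin.ofNat, Nat.mod_eq_of_lt a.2]
  rw [stepCoeff, h1, h2]

theorem exists_step_index (m : ℕ) [NeZero m] (n : ℕ) : ∃ (l : ℕ) (a : Fin m), n = l * m + a :=
  ⟨n / m, Fin.ofNat m n, by simpa [Fin.ofNat] using (Nat.div_add_mod' n m).symm⟩

theorem step_index_inj {l l' : ℕ} {a a' : Fin m} :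
    l * m + (a : ℕ) = l' * m + a' ↔ l = l' ∧ a = a' := by
  constructor
  · intro h
    have h1 := congrArg (· / m) h
    have h2 := congrArg (· % m) h
    simp only [mul_comm _ m, Nat.mul_add_div (NeZero.pos m),
      Nat.div_eq_of_lt a.2, Nat.div_eq_of_lt a'.2, Nat.mul_add_mod, Nat.mod_eq_of_lt a.2,
      Nat.mod_eq_of_lt a'.2, add_zero] at h1 h2
    exact ⟨h1, Fin.ext h2⟩
  · rintro ⟨rfl, rfl⟩
    rfl

theorem stepMonomial_mul_add (l : ℕ) (a : Fin m) :
    stepMonomial m (l * m + a) = Pi.single a (X ^ l) := by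
  have h1 : (l * m + (a : ℕ)) / m = l := by
    rw [mul_comm, Nat.mul_add_div (NeZero.pos m), Nat.div_eq_of_lt a.2, add_zero]
  have h2 : Fin.ofNat m (l * m + (a : ℕ)) = a := by
    ext
    simp [Fin.ofNat, Nat.mod_eq_of_lt a.2]
  rw [stepMonomial, h1, h2]

theorem stepCoeff_stepMonomial (n k : ℕ) :
    stepCoeff (stepMonomial m n) k = if k = n then 1 else 0 := by
  obtain ⟨l, a, rfl⟩ := exists_step_index m n
  obtain ⟨l', a', rfl⟩ := exists_step_index m k
  rw [stepMonomial_mul_add, stepCoeff_mul_add]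
  simp only [step_index_inj]
  by_cases h : a' = a
  · subst h
    simp [coeff_X_pow]
  · simp [h]

theorem stepCoeff_ext {P Q : Fin m → ℂ[X]} (h : ∀ k, stepCoeff P k = stepCoeff Q k) : P = Q := by
  funext a
  ext l
  rw [← stepCoeff_mul_add, ← stepCoeff_mul_add, h]

theorem stepCoeff_add (P Q : Fin m → ℂ[X]) (k : ℕ) :
    stepCoeff (P + Q) k = stepCoeff P k + stepCoeff Q k := by simp [stepCoeff]

theorem stepCoeff_sub (P Q : Fin m → ℂ[X]) (k : ℕ) :
    stepCoeff (P - Q) k = stepCoeff P k - stepCoeff Q k := by simp [stepCoeff]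

theorem stepCoeff_smul (c : ℂ) (P : Fin m → ℂ[X]) (k : ℕ) :
    stepCoeff (c • P) k = c * stepCoeff P k := by simp [stepCoeff]

theorem stepCoeff_sum {ι : Type*} (s : Finset ι) (P : ι → Fin m → ℂ[X]) (k : ℕ) :
    stepCoeff (∑ i ∈ s, P i) k = ∑ i ∈ s, stepCoeff (P i) k := by
  simp [stepCoeff, Finset.sum_apply]

theorem isStepMonic_stepMonomial (n : ℕ) : IsStepMonic (stepMonomial m n) n :=
  ⟨by simp [stepCoeff_stepMonomial], fun k hk => by simp [stepCoeff_stepMonomial, hk.ne']⟩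

theorem IsStepMonic.hasStepDegree {P : Fin m → ℂ[X]} {n : ℕ} (h : IsStepMonic P n) :
    HasStepDegree P n := ⟨by simp [h.1], h.2⟩

theorem StepLT.eq_sum {P : Fin m → ℂ[X]} {n : ℕ} (h : StepLT P n) :
    P = ∑ k : Fin n, stepCoeff P k • stepMonomial m k := by
  refine stepCoeff_ext fun k => ?_
  rw [stepCoeff_sum, Finset.sum_fin_eq_sum_range]
  simp only [stepCoeff_smul, stepCoeff_stepMonomial]
  by_cases hk : k < n
  · rw [Finset.sum_eq_single k] <;> grind
  · rw [h k (not_lt.1 hk), Finset.sum_eq_zero]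
    grind

theorem HasStepDegree.stepLT {P : Fin m → ℂ[X]} {n j : ℕ} (h : HasStepDegree P n) (hj : n < j) :
    StepLT P j := fun k hk => h.2 k (hj.trans_le hk)

/-- A functional which vanishes on polynomials of all step degrees below `n` vanishes on every
polynomial of step degree less than `n`. -/
theorem StepLT.map_eq_zero {f : (Fin m → ℂ[X]) →ₗ[ℂ] ℂ} {Y : ℕ → Fin m → ℂ[X]} {n : ℕ}
    (hY : ∀ k, HasStepDegree (Y k) k) (hf : ∀ k, k < n → f (Y k) = 0)
    {Q : Fin m → ℂ[X]} (hQ : StepLT Q n) : f Q = 0 := by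
  induction n generalizing Q with
  | zero =>
    have : Q = 0 := stepCoeff_ext fun k => by simpa [stepCoeff] using hQ k (Nat.zero_le k)
    simp [this]
  | succ n ih =>
    have h1 : StepLT (Q - (stepCoeff Q n / stepCoeff (Y n) n) • Y n) n := by
      intro k hk
      rw [stepCoeff_sub, stepCoeff_smul]
      rcases hk.eq_or_lt with rfl | hk
      · rw [div_mul_cancel₀ _ (hY n).1, sub_self]
      · rw [hQ k hk, (hY n).2 k hk, mul_zero, sub_zero]
    have h2 := ih (fun k hk => hf k (hk.trans n.lt_succ_self)) h1
    rwa [map_sub, map_smul, hf n n.lt_succ_self, smul_zero, sub_zero] at h2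

end StepLine

/-! ### Linear algebra: biorthogonality from nonvanishing determinants -/

section Existence

variable {p q : ℕ} [NeZero p] [NeZero q]

/-- Orthogonality exists as soon as there are monic polynomials which are orthogonal to the lower
step-line monomials and not to the one of the same index. -/
theorem orthogonalityExists_of_monic (G : (Fin q → ℂ[X]) →ₗ[ℂ] (Fin p → ℂ[X]) →ₗ[ℂ] ℂ)
    (Bc : ℕ → Fin q → ℂ[X]) (hm : ∀ n, IsStepMonic (Bc n) n)
    (h0 : ∀ n k, k < n → G (Bc n) (stepMonomial p k) = 0)
    (h1 : ∀ n, G (Bc n) (stepMonomial p n) ≠ 0) :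
    OrthogonalityExists fun P Q => G P Q := by
  have key : ∀ k, ∃ A : Fin p → ℂ[X], HasStepDegree A k ∧
      ∀ n, G (Bc n) A = if n = k then 1 else 0 := by
    intro k
    induction k using Nat.strong_induction_on with
    | _ k ih =>
      choose A hA hGA using ih
      -- Gram–Schmidt: S has the same pairings as the k-th monomial with `Bc n` for n < k, and pairs
      -- to zero with the others.
      set S := ∑ j : Fin k, G (Bc j) (stepMonomial p k) • A j j.2 with hS
      have hSk : ∀ i, k ≤ i → stepCoeff S i = 0 := by
        intro i hi
        rw [hS, stepCoeff_sum]
        refine Finset.sum_eq_zero fun j _ => ?_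
        rw [stepCoeff_smul, (hA j j.2).2 i (j.2.trans_le hi), mul_zero]
      have hd := h1 k
      refine ⟨(G (Bc k) (stepMonomial p k))⁻¹ • (stepMonomial p k - S), ⟨?_, fun i hi => ?_⟩,
        fun n => ?_⟩
      · rw [stepCoeff_smul, stepCoeff_sub, hSk k le_rfl, stepCoeff_stepMonomial, if_pos rfl]
        simpa using hd
      · rw [stepCoeff_smul, stepCoeff_sub, hSk i hi.le, stepCoeff_stepMonomial, if_neg hi.ne']
        simp
      · have hGS : G (Bc n) S = if n < k then G (Bc n) (stepMonomial p k) else 0 := by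
          rw [hS, map_sum]
          simp only [map_smul, hGA, smul_eq_mul, mul_ite, mul_one, mul_zero]
          split_ifs with hn
          · rw [Finset.sum_eq_single ⟨n, hn⟩]
            · simp
            · intro j _ hj
              rw [if_neg]
              rintro rfl
              exact hj rfl
            · simp
          · refine Finset.sum_eq_zero fun j _ => ?_
            rw [if_neg]
            have := j.2
            omega
        rw [map_smul, map_sub, hGS]
        rcases lt_trichotomy n k with h | rfl | h
        · simp [h, h.ne]
        · simp [hd]
        · simp [h.not_gt, h.ne', h0 n k h]
  choose A hA hGA using key
  exact ⟨Bc, A, hm, hA, fun n k => hGA k n⟩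

variable {B : ℕ → Fin q → ℂ[X]} {A : ℕ → Fin p → ℂ[X]}
  {L G : (Fin q → ℂ[X]) →ₗ[ℂ] (Fin p → ℂ[X]) →ₗ[ℂ] ℂ}

theorem IsBiorthogonal.eq_zero_of_stepLT (h : IsBiorthogonal (fun P Q => L P Q) B A) {n : ℕ}
    {Q : Fin p → ℂ[X]} (hQ : StepLT Q n) : L (B n) Q = 0 :=
  StepLT.map_eq_zero h.degree_A (fun k hk => by rw [h.biorthogonal, if_neg hk.ne']) hQ

/-- Otherwise `B n` would annihilate all step degrees up to n, in particular `A n`, against L(B_n,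
A_n) = 1. -/
theorem IsBiorthogonal.ne_zero (h : IsBiorthogonal (fun P Q => L P Q) B A) (n : ℕ) :
    L (B n) (stepMonomial p n) ≠ 0 := by
  intro h0
  have h1 : L (B n) (A n) = 0 := by
    refine StepLT.map_eq_zero (n := n + 1) (fun k => (isStepMonic_stepMonomial k).hasStepDegree)
      (fun k hk => ?_) ((h.degree_A n).stepLT n.lt_succ_self)
    rcases (Nat.lt_succ_iff.1 hk).eq_or_lt with rfl | hk
    · exact h0
    · exact h.eq_zero_of_stepLT ((isStepMonic_stepMonomial k).hasStepDegree.stepLT hk)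
  rw [h.biorthogonal, if_pos rfl] at h1
  exact one_ne_zero h1

/-- A combination of monic polynomials of consecutive step degrees with leading coefficient one. -/
theorem isStepMonic_add_sum (hB : ∀ n, IsStepMonic (B n) n) (n K : ℕ) (hK : K ≤ n)
    (c : Fin K → ℂ) : IsStepMonic (B n + ∑ j, c j • B (n - K + j)) n := by
  have h : ∀ i, n ≤ i → stepCoeff (∑ j, c j • B (n - K + j)) i = 0 := by
    intro i hi
    rw [stepCoeff_sum]
    refine Finset.sum_eq_zero fun j _ => ?_
    rw [stepCoeff_smul, (hB _).2 i (by have := j.2; omega), mul_zero]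
  exact ⟨by rw [stepCoeff_add, h n le_rfl, add_zero, (hB n).1],
    fun k hk => by rw [stepCoeff_add, h k hk.le, add_zero, (hB n).2 k hk]⟩

/-- If the determinant of the pairings of `K` monic polynomials with the first `K` step-line
monomials does not vanish, then orthogonal polynomials of index less than `K` have nonzero
pairing with the monomial of the same index. -/
theorem initial_ne_zero {K : ℕ} (hK : 0 < K)
    (hdet : (Matrix.of fun j c : Fin K =>
      G (B (K - 1 + 1 - K + j)) (stepMonomial p c)).det ≠ 0)
    (hB : ∀ n, IsStepMonic (B n) n) {P : ℕ → Fin q → ℂ[X]}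
    (hP : ∀ n, n < K → IsStepMonic (P n) n)
    (hGP : ∀ n, n < K → ∀ k, k < n → G (P n) (stepMonomial p k) = 0) {n : ℕ} (hn : n < K) :
    G (P n) (stepMonomial p n) ≠ 0 := by
  intro h0
  refine hdet ?_
  have h1 : (Matrix.of fun j c : Fin K => G (P j) (stepMonomial p c)).det = 0 := by
    rw [Matrix.det_of_isUpperTriangular]
    · exact Finset.prod_eq_zero (Finset.mem_univ (⟨n, hn⟩ : Fin K)) h0
    · exact fun i j hij => hGP i i.2 j hij
  -- The column Σ v_c e_c is paired to zero with P_0, …, P_{K-1}, hence with every row of step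
  -- degree below K. Since K - 1 + 1 - K = 0, the rows in `hdet` are B_0, …, B_{K-1}, which are
  -- among them.
  obtain ⟨v, hv, hv0⟩ := Matrix.exists_mulVec_eq_zero_iff.2 h1
  refine Matrix.exists_mulVec_eq_zero_iff.1 ⟨v, hv, ?_⟩
  have hsum : ∀ Q : Fin q → ℂ[X], G.flip (∑ c : Fin K, v c • stepMonomial p c) Q =
      ∑ c : Fin K, G Q (stepMonomial p c) * v c := by
    intro Q
    simp [mul_comm]
  -- The monomials are only a filler, giving a family with a member in every step degree.
  have hY : ∀ k, HasStepDegree (if k < K then P k else stepMonomial q k) k := by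
    intro k
    split_ifs with hk
    · exact (hP k hk).hasStepDegree
    · exact (isStepMonic_stepMonomial k).hasStepDegree
  have hfP : ∀ k, k < K → G.flip (∑ c : Fin K, v c • stepMonomial p c)
      (if k < K then P k else stepMonomial q k) = 0 := by
    intro k hk
    rw [if_pos hk, hsum]
    exact congrFun hv0 ⟨k, hk⟩
  funext j
  have := StepLT.map_eq_zero hY hfP
    ((hB (K - 1 + 1 - K + j)).hasStepDegree.stepLT (j := K) (by have := j.2; omega))
  rw [hsum] at this
  exact this

/-- The monic orthogonal polynomials of index at least `K` are combinations of `K + 1` consecutive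
polynomials `B`. -/
theorem exists_orthogonal {K : ℕ} (hK : 0 < K)
    (h : IsBiorthogonal (fun P Q => L P Q) B A)
    (T : (Fin p → ℂ[X]) →ₗ[ℂ] (Fin p → ℂ[X]))
    (hT : ∀ n, IsStepMonic (T (stepMonomial p n)) (n + K))
    (hG : ∀ P Q, G P (T Q) = L P Q)
    (hdet : ∀ n, K ≤ n + 1 → (Matrix.of fun j c : Fin K =>
      G (B (n + 1 - K + j)) (stepMonomial p c)).det ≠ 0) {n : ℕ} (hn : K ≤ n) :
    ∃ P : Fin q → ℂ[X], IsStepMonic P n ∧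
      (∀ k, k < n → G P (stepMonomial p k) = 0) ∧ G P (stepMonomial p n) ≠ 0 := by
  -- The rows of this matrix are those of B_{n-K}, …, B_{n-1}; B_n supplies the right-hand side.
  have hM := hdet (n - 1) (by omega)
  rw [show n - 1 + 1 = n by omega] at hM
  set M := Matrix.of fun j c : Fin K => G (B (n - K + j)) (stepMonomial p c) with hMdef
  set b : Fin K → ℂ := fun c => G (B n) (stepMonomial p c) with hb
  set c : Fin K → ℂ := -(b ᵥ* M⁻¹) with hc
  have hcM : c ᵥ* M = -b := by
    rw [hc, Matrix.neg_vecMul, Matrix.vecMul_vecMul,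
      Matrix.nonsing_inv_mul _ (isUnit_iff_ne_zero.2 hM),
      Matrix.vecMul_one]
  set P := B n + ∑ j, c j • B (n - K + j) with hPdef
  have hGP : ∀ Q, G P Q = G (B n) Q + ∑ j, c j * G (B (n - K + j)) Q := by
    intro Q
    simp [hPdef]
  have hLP : ∀ Q, L P Q = L (B n) Q + ∑ j, c j * L (B (n - K + j)) Q := by
    intro Q
    simp [hPdef]
  have hlow : ∀ a : Fin K, G P (stepMonomial p a) = 0 := by
    intro a
    rw [hGP]
    have := congrFun hcM a
    simp only [Matrix.vecMul, dotProduct, Pi.neg_apply, hMdef, Matrix.of_apply, hb] at this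
    rw [this, add_neg_cancel]
  -- Every `B` occurring in P has index at least n - K > i.
  have hstepT : ∀ i, i + K < n → G P (T (stepMonomial p i)) = 0 := by
    intro i hi
    have h0 : ∀ m, i < m → L (B m) (stepMonomial p i) = 0 := fun m hm =>
      h.eq_zero_of_stepLT ((isStepMonic_stepMonomial i).hasStepDegree.stepLT hm)
    rw [hG, hLP, h0 n (by omega), zero_add]
    exact Finset.sum_eq_zero fun j _ => by rw [h0 _ (by omega), mul_zero]
  have hvan : ∀ Q, StepLT Q n → G P Q = 0 := by
    intro Q hQ
    -- Test family with one column in each step degree: the linear system handles k < K, the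
    -- original orthogonality the rest.
    refine StepLT.map_eq_zero (Y := fun k => if k < K then stepMonomial p k else
      T (stepMonomial p (k - K))) (fun k => ?_) (fun k hk => ?_) hQ
    · split_ifs with hk
      · exact (isStepMonic_stepMonomial k).hasStepDegree
      · simpa [Nat.sub_add_cancel (not_lt.1 hk)] using (hT (k - K)).hasStepDegree
    · split_ifs with hkK
      · exact hlow ⟨k, hkK⟩
      · exact hstepT _ (by omega)
  refine ⟨P, isStepMonic_add_sum h.monic_B n K hn c, fun k hk => hvan _
    ((isStepMonic_stepMonomial k).hasStepDegree.stepLT hk), fun h0 => ?_⟩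
  have hTn := hT (n - K)
  rw [Nat.sub_add_cancel hn] at hTn
  have h1 : G P (T (stepMonomial p (n - K))) = 0 := by
    have h2 : StepLT (T (stepMonomial p (n - K)) - stepMonomial p n) n := by
      intro k hk
      rw [stepCoeff_sub]
      rcases hk.eq_or_lt with rfl | hk
      · rw [hTn.1, (isStepMonic_stepMonomial _).1, sub_self]
      · rw [hTn.2 k hk, (isStepMonic_stepMonomial _).2 k hk, sub_self]
    have h3 := hvan _ h2
    rwa [map_sub, h0, sub_zero] at h3
  obtain ⟨K, rfl⟩ : ∃ K', K = K' + 1 := ⟨K - 1, by omega⟩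
  -- In L(P, e_{n-K}) only the term of B_{n-K} survives, and its pairing with e_{n-K} is nonzero.
  have hc0 : c 0 = 0 := by
    have h0 : ∀ m, n - (K + 1) < m → L (B m) (stepMonomial p (n - (K + 1))) = 0 := fun m hm =>
      h.eq_zero_of_stepLT ((isStepMonic_stepMonomial _).hasStepDegree.stepLT hm)
    rw [hG, hLP, h0 n (by omega), zero_add, Fin.sum_univ_succ, Finset.sum_eq_zero, add_zero] at h1
    · exact (mul_eq_zero.1 h1).resolve_right (h.ne_zero _)
    · intro j _
      rw [h0 _ (by simp), mul_zero]
  -- With c 0 = 0, P involves only B_{n-K+1}, …, B_n (original K). Its coefficients, c without entry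
  -- 0 followed by 1, form a nonzero left null vector of the matrix at index n.
  refine hdet n (by omega) (Matrix.exists_vecMul_eq_zero_iff.1
    ⟨Fin.snoc (α := fun _ => ℂ) (fun j : Fin K => c j.succ) 1, fun hw => ?_, ?_⟩)
  · simpa using congrFun hw (Fin.last K)
  · funext a
    have h4 := hlow a
    rw [hGP, Fin.sum_univ_succ, hc0, zero_mul, zero_add] at h4
    simp only [Matrix.vecMul, dotProduct, Matrix.of_apply, Pi.zero_apply]
    rw [Fin.sum_univ_castSucc, add_comm]
    simp only [Fin.snoc_castSucc, Fin.snoc_last, Fin.val_last, Fin.val_castSucc, one_mul]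
    rw [← h4]
    congr 1
    · rw [show n + 1 - (K + 1) + K = n by omega]
    · refine Finset.sum_congr rfl fun j _ => ?_
      rw [Fin.val_succ, show n + 1 - (K + 1) + (j : ℕ) = n - (K + 1) + (j + 1) by omega]

/-- If the determinants of the pairings of `K` consecutive polynomials `B` with the first `K`
step-line monomials do not vanish, then orthogonality exists for `G` when it exists for
`L = G ∘ T`, where `T` raises the step degree by `K`, and when the first `K` polynomials exist. -/
theorem orthogonalityExists_of_det_ne_zero {K : ℕ} (hK : 0 < K)
    (h : IsBiorthogonal (fun P Q => L P Q) B A)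
    (T : (Fin p → ℂ[X]) →ₗ[ℂ] (Fin p → ℂ[X]))
    (hT : ∀ n, IsStepMonic (T (stepMonomial p n)) (n + K))
    (hG : ∀ P Q, G P (T Q) = L P Q)
    (hdet : ∀ n, K ≤ n + 1 → (Matrix.of fun j c : Fin K =>
      G (B (n + 1 - K + j)) (stepMonomial p c)).det ≠ 0)
    (Bi : ∀ n, n < K → ∃ P : Fin q → ℂ[X], IsStepMonic P n ∧
      ∀ k, k < n → G P (stepMonomial p k) = 0) :
    OrthogonalityExists fun P Q => G P Q := by
  have key : ∀ n, ∃ P : Fin q → ℂ[X], IsStepMonic P n ∧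
      (∀ k, k < n → G P (stepMonomial p k) = 0) ∧ G P (stepMonomial p n) ≠ 0 := by
    intro n
    by_cases hn : n < K
    · choose! P hP hGP using Bi
      exact ⟨P n, hP n hn, hGP n hn, initial_ne_zero hK (hdet (K - 1) (by omega)) h.monic_B hP hGP hn⟩
    · exact exists_orthogonal hK h T hT hG hdet (not_lt.1 hn)
  choose Bc h1 h2 h3 using key
  exact orthogonalityExists_of_monic G Bc h1 h2 h3

end Existence

/-! ### Consequences of the leading coefficients: degree of det R and shift of the step degree -/

section Leading

theorem step_index_lt {m : ℕ} {l l' : ℕ} {a a' : Fin m} :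
    l * m + (a : ℕ) < l' * m + a' ↔ l < l' ∨ (l = l' ∧ (a : ℕ) < a') := by
  have ha := a.2
  have ha' := a'.2
  rcases lt_trichotomy l l' with h | rfl | h
  · have := Nat.mul_le_mul_right m (Nat.succ_le_of_lt h)
    rw [Nat.succ_mul] at this
    omega
  · omega
  · have := Nat.mul_le_mul_right m (Nat.succ_le_of_lt h)
    rw [Nat.succ_mul] at this
    omega

/-- The coefficient of degree `n` of the determinant of a matrix polynomial of degree `n`. -/
theorem coeff_det_of_natDegree_le {p : ℕ} (R : Matrix (Fin p) (Fin p) ℂ[X]) (n : ℕ)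
    (h : ∀ a c, (R a c).natDegree ≤ n) :
    R.det.coeff (p * n) = (R.map fun f => f.coeff n).det := by
  rw [Matrix.det_apply, Matrix.det_apply, finsetSum_coeff]
  refine Finset.sum_congr rfl fun g _ => ?_
  have := coeff_prod_of_natDegree_le (s := Finset.univ) (fun i => R (g i) i) n
    fun i _ => h (g i) i
  rw [Finset.card_univ, Fintype.card_fin] at this
  rw [coeff_smul, this]
  rfl

theorem natDegree_det_le {p : ℕ} (R : Matrix (Fin p) (Fin p) ℂ[X]) (n : ℕ)
    (h : ∀ a c, (R a c).natDegree ≤ n) : R.det.natDegree ≤ p * n := by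
  rw [Matrix.det_apply]
  refine natDegree_sum_le_of_forall_le _ _ fun g _ => ?_
  refine (natDegree_smul_le _ _).trans ((natDegree_prod_le _ _).trans ?_)
  exact (Finset.sum_le_card_nsmul _ _ n fun i _ => h (g i) i).trans (by simp)

variable {p N r : ℕ} {R : Matrix (Fin p) (Fin p) ℂ[X]}

theorem LeadingCondition.natDegree_lt (hR : LeadingCondition N r R) (hN : 0 < N) (a c : Fin p)
    (hc : (c : ℕ) < r) : (R a c).natDegree < N := by
  refine lt_of_le_of_ne (hR.degree_le a c) fun h => ?_
  have h1 := hR.leading a c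
  rw [if_neg (by omega), ← h, coeff_natDegree, leadingCoeff_eq_zero] at h1
  rw [h1, natDegree_zero] at h
  omega

/-- Multiplying the first r columns by x makes the coefficient of degree N equal to the block matrix
[*, I; I, 0], which is invertible; so det R · x^r has degree exactly Np. -/
theorem LeadingCondition.natDegree_det (hR : LeadingCondition N r R) (hN : 0 < N) (hr : r < p) :
    R.det.natDegree = N * p - r := by
  set d : Fin p → ℂ[X] := fun c => if (c : ℕ) < r then X else 1 with hd
  have hRd : ∀ a c, (R * Matrix.diagonal d) a c = if (c : ℕ) < r then R a c * X else R a c := by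
    intro a c
    rw [Matrix.mul_diagonal, hd]
    dsimp only
    rw [mul_ite, mul_one]
  have hdeg : ∀ a c, ((R * Matrix.diagonal d) a c).natDegree ≤ N := by
    intro a c
    rw [hRd]
    split_ifs with hc
    · exact natDegree_mul_le.trans (by
        have := hR.natDegree_lt hN a c hc
        rw [natDegree_X]
        omega)
    · exact hR.degree_le a c
  have hprod : ∏ c, d c = X ^ r := by
    rw [hd, Finset.prod_ite, Finset.prod_const, Finset.prod_const_one, mul_one]
    exact congrArg (X ^ ·) (Fin.card_filter_val_lt.trans (min_eq_right hr.le))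
  set Lm := (R * Matrix.diagonal d).map fun f => f.coeff N with hL
  have hLapp : ∀ a c, Lm a c = if (c : ℕ) < r then (R a c).coeff (N - 1) else
      if (c : ℕ) = a + r then 1 else 0 := by
    intro a c
    rw [hL, Matrix.map_apply, hRd]
    split_ifs with h1 h2
    · obtain ⟨M, rfl⟩ : ∃ M, N = M + 1 := ⟨N - 1, by omega⟩
      rw [coeff_mul_X]
      rfl
    · rw [hR.leading, if_pos h2]
    · rw [hR.leading, if_neg h2]
  -- For a null vector v, the last r rows give v_c = 0 for c < r; the first p - r rows then kill the
  -- other entries.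
  have hdet : Lm.det ≠ 0 := by
    intro h0
    obtain ⟨v, hv, hv0⟩ := Matrix.exists_mulVec_eq_zero_iff.2 h0
    have hlow : ∀ c : Fin p, (c : ℕ) < r → v c = 0 := by
      intro c hc
      have h1 := congrFun hv0 ⟨p - r + c, by omega⟩
      simp only [Matrix.mulVec, dotProduct, Pi.zero_apply] at h1
      rw [Finset.sum_eq_single c] at h1
      · rwa [hLapp, if_pos hc, hR.subleading _ _ (by simp) hc, if_pos rfl, one_mul] at h1
      · intro c' _ hcc
        rw [hLapp]
        split_ifs with h2 h3
        · rw [hR.subleading _ _ (by simp) h2, if_neg, zero_mul]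
          intro h4
          simp only [add_right_inj] at h4
          exact hcc (Fin.ext h4.symm)
        · have := c'.2
          simp only at h3
          omega
        · rw [zero_mul]
      · simp
    refine hv (funext fun c => ?_)
    by_cases hc : (c : ℕ) < r
    · exact hlow c hc
    · have hc2 := c.2
      have h1 := congrFun hv0 ⟨c - r, by omega⟩
      simp only [Matrix.mulVec, dotProduct, Pi.zero_apply] at h1
      rw [Finset.sum_eq_single c] at h1
      · rwa [hLapp, if_neg hc, if_pos (by simp only; omega), one_mul] at h1
      · intro c' _ hcc
        rw [hLapp]
        split_ifs with h2 h3
        · rw [hlow c' h2, mul_zero]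
        · exact absurd (Fin.ext (by simp only at h3; omega)) hcc
        · rw [zero_mul]
      · simp
  rw [← coeff_det_of_natDegree_le _ _ hdeg] at hdet
  have h1 : (R * Matrix.diagonal d).det.natDegree = p * N :=
    le_antisymm (natDegree_det_le _ _ hdeg) (le_natDegree_of_ne_zero hdet)
  have h0 : R.det ≠ 0 := by
    intro h
    rw [Matrix.det_mul, h, zero_mul, coeff_zero] at hdet
    exact hdet rfl
  rw [Matrix.det_mul, Matrix.det_diagonal, hprod, natDegree_mul h0 (by simp), natDegree_X_pow,
    mul_comm] at h1
  omega

/-- Over ℂ the degree counts the roots with multiplicity, and the chain lengths at each root add up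
to its multiplicity. -/
theorem CanonicalJordanData.size_eq (J : CanonicalJordanData R) (h0 : R.det ≠ 0) :
    J.size = R.det.natDegree := by
  rw [← IsAlgClosed.card_roots_eq_natDegree, CanonicalJordanData.size,
    ← Multiset.toFinset_sum_count_eq]
  have : R.det.roots.toFinset = Finset.univ.image J.x := by
    ext z
    simp [h0, J.det_eq_zero_iff]
  rw [this, Finset.sum_image J.x_injective.injOn]
  exact Finset.sum_congr rfl fun i _ => by rw [J.sum_κ, count_roots]

/-- Multiplication of column vectors by a matrix polynomial, as a `ℂ`-linear map. -/
def mulVecMap (R : Matrix (Fin p) (Fin p) ℂ[X]) : (Fin p → ℂ[X]) →ₗ[ℂ] (Fin p → ℂ[X]) :=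
  R.mulVecLin.restrictScalars ℂ

theorem mulVecMap_apply (Q : Fin p → ℂ[X]) : mulVecMap R Q = R *ᵥ Q := rfl

/-- Multiplication by `R` raises the step degree by `N p - r`. -/
theorem LeadingCondition.isStepMonic_mulVec [NeZero p] (hR : LeadingCondition N r R) (hN : 0 < N)
    (hr : r < p) (n : ℕ) :
    IsStepMonic (mulVecMap R (stepMonomial p n)) (n + (N * p - r)) := by
  obtain ⟨l, c, rfl⟩ := exists_step_index p n
  have hcoeff : ∀ l' (a : Fin p), stepCoeff (mulVecMap R (stepMonomial p (l * p + c))) (l' * p + a)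
      = if l ≤ l' then (R a c).coeff (l' - l) else 0 := by
    intro l' a
    rw [stepCoeff_mul_add, stepMonomial_mul_add, mulVecMap_apply, Matrix.mulVec_single]
    simp [coeff_mul_X_pow']
  have hc2 := c.2
  obtain ⟨M, rfl⟩ : ∃ M, N = M + 1 := ⟨N - 1, by omega⟩
  -- In column c of R the last step-line term is x^(N-1) in row p - r + c if c < r (from R_{N-1}),
  -- and x^N in row c - r otherwise (from R_N). Both have step index Np - r + c.
  by_cases hc : (c : ℕ) < r
  · have hidx : l * p + c + ((M + 1) * p - r) =
        (l + M) * p + (⟨p - r + c, by omega⟩ : Fin p) := by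
      simp only [add_mul]
      omega
    rw [hidx]
    refine ⟨?_, fun k hk => ?_⟩
    · rw [hcoeff, if_pos (by omega), Nat.add_sub_cancel_left]
      exact (hR.subleading _ _ (by simp) hc).trans (by simp)
    · obtain ⟨l', a, rfl⟩ := exists_step_index p k
      rw [hcoeff]
      rw [step_index_lt] at hk
      split_ifs with hl
      · rcases hk with hk | ⟨rfl, hk⟩
        · exact coeff_eq_zero_of_natDegree_lt (by
            have := hR.natDegree_lt hN a c hc
            omega)
        · rw [Nat.add_sub_cancel_left]
          simp only at hk
          refine (hR.subleading a c (by omega) hc).trans (if_neg (by omega))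
      · rfl
  · have hidx : l * p + c + ((M + 1) * p - r) =
        (l + (M + 1)) * p + (⟨c - r, by omega⟩ : Fin p) := by
      simp only [add_mul]
      omega
    rw [hidx]
    refine ⟨?_, fun k hk => ?_⟩
    · rw [hcoeff, if_pos (by omega), Nat.add_sub_cancel_left, hR.leading, if_pos]
      simp only
      omega
    · obtain ⟨l', a, rfl⟩ := exists_step_index p k
      rw [hcoeff]
      rw [step_index_lt] at hk
      split_ifs with hl
      · rcases hk with hk | ⟨rfl, hk⟩
        · exact coeff_eq_zero_of_natDegree_lt (by
            have := hR.degree_le a c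
            omega)
        · rw [Nat.add_sub_cancel_left, hR.leading, if_neg]
          simp only at hk
          omega
      · rfl

end Leading

/-! ### Taylor series as formal power series -/

section TaylorSeries

/-- The Taylor series of a function at a point. -/
def taylorSeries (f : ℂ → ℂ) (x : ℂ) : PowerSeries ℂ :=
  PowerSeries.mk fun l => (1 / (l ! : ℂ)) * iteratedDeriv l f x

theorem coeff_taylorSeries (f : ℂ → ℂ) (x : ℂ) (l : ℕ) :
    PowerSeries.coeff l (taylorSeries f x) = (1 / (l ! : ℂ)) * iteratedDeriv l f x :=
  PowerSeries.coeff_mk _ _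

theorem taylorSeries_congr {f g : ℂ → ℂ} {x : ℂ} (h : f =ᶠ[𝓝 x] g) :
    taylorSeries f x = taylorSeries g x := by
  ext l
  rw [coeff_taylorSeries, coeff_taylorSeries, h.iteratedDeriv_eq]

theorem taylorSeries_mul {f g : ℂ → ℂ} {x : ℂ} (hf : AnalyticAt ℂ f x) (hg : AnalyticAt ℂ g x) :
    taylorSeries (fun z => f z * g z) x = taylorSeries f x * taylorSeries g x := by
  ext l
  rw [coeff_taylorSeries, PowerSeries.coeff_mul, iteratedDeriv_fun_mul hf.contDiffAt hg.contDiffAt,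
    Finset.Nat.sum_antidiagonal_eq_sum_range_succ_mk, Finset.mul_sum]
  refine Finset.sum_congr rfl fun i hi => ?_
  have hi' : i ≤ l := Nat.lt_succ_iff.1 (Finset.mem_range.1 hi)
  rw [coeff_taylorSeries, coeff_taylorSeries, Nat.cast_choose ℂ hi']
  have h1 : (l ! : ℂ) ≠ 0 := Nat.cast_ne_zero.2 l.factorial_ne_zero
  have h2 : (i ! : ℂ) ≠ 0 := Nat.cast_ne_zero.2 i.factorial_ne_zero
  have h3 : ((l - i)! : ℂ) ≠ 0 := Nat.cast_ne_zero.2 (l - i).factorial_ne_zero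
  field_simp

theorem taylorSeries_sum {ι : Type*} (s : Finset ι) {f : ι → ℂ → ℂ} {x : ℂ}
    (hf : ∀ i ∈ s, AnalyticAt ℂ (f i) x) :
    taylorSeries (fun z => ∑ i ∈ s, f i z) x = ∑ i ∈ s, taylorSeries (f i) x := by
  ext l
  rw [map_sum, coeff_taylorSeries, iteratedDeriv_fun_sum fun i hi => (hf i hi).contDiffAt,
    Finset.mul_sum]
  simp only [coeff_taylorSeries]

theorem iteratedDeriv_polynomial (Q : ℂ[X]) (l : ℕ) :
    iteratedDeriv l (fun z => Q.eval z) = fun z => (derivative^[l] Q).eval z := by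
  induction l generalizing Q with
  | zero => simp
  | succ l ih =>
    rw [iteratedDeriv_succ', Function.iterate_succ_apply, ← ih]
    congr 1
    funext z
    exact Q.deriv

theorem coeff_taylor_eq (Q : ℂ[X]) (x : ℂ) (l : ℕ) :
    (taylor x Q).coeff l = (1 / (l ! : ℂ)) * (derivative^[l] Q).eval x := by
  have h1 : (l ! : ℂ) ≠ 0 := Nat.cast_ne_zero.2 l.factorial_ne_zero
  rw [taylor_coeff, ← factorial_smul_hasseDeriv, LinearMap.smul_apply, eval_smul, nsmul_eq_mul]
  field_simp

theorem taylorSeries_polynomial (Q : ℂ[X]) (x : ℂ) :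
    taylorSeries (fun z => Q.eval z) x = (taylor x Q : PowerSeries ℂ) := by
  ext l
  rw [coeff_taylorSeries, iteratedDeriv_polynomial, Polynomial.coeff_coe, coeff_taylor_eq]

theorem coe_powerSeries_sum {ι : Type*} (s : Finset ι) (f : ι → ℂ[X]) :
    ((∑ i ∈ s, f i : ℂ[X]) : PowerSeries ℂ) = ∑ i ∈ s, (f i : PowerSeries ℂ) := by
  simp only [← Polynomial.coeToPowerSeries.ringHom_apply, map_sum]

theorem coe_taylor_sum_mul {ι : Type*} (s : Finset ι) (f g : ι → ℂ[X]) (x : ℂ) :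
    ((taylor x (∑ i ∈ s, f i * g i) : ℂ[X]) : PowerSeries ℂ) =
      ∑ i ∈ s, (taylor x (f i) : PowerSeries ℂ) * (taylor x (g i) : PowerSeries ℂ) := by
  rw [map_sum, coe_powerSeries_sum]
  simp only [taylor_mul, Polynomial.coe_mul]

theorem analyticAt_polynomial (Q : ℂ[X]) (x : ℂ) : AnalyticAt ℂ (fun z => Q.eval z) x :=
  AnalyticAt.aeval_polynomial analyticAt_id Q

theorem analyticAt_sub_inv {z x : ℂ} (h : z ≠ x) : AnalyticAt ℂ (fun t => (z - t)⁻¹) x :=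
  (analyticAt_const.sub analyticAt_id).inv (sub_ne_zero.2 h)

/-- Lets division by z - t be carried out among power series, where t - x is the variable. -/
theorem taylorSeries_sub_inv_mul {z x : ℂ} (h : z ≠ x) :
    taylorSeries (fun t => (z - t)⁻¹) x * ((taylor x (C z - X) : ℂ[X]) : PowerSeries ℂ) = 1 := by
  rw [← taylorSeries_polynomial, ← taylorSeries_mul (analyticAt_sub_inv h)
    (analyticAt_polynomial _ _)]
  have h1 : (fun t => (z - t)⁻¹ * (C z - X : ℂ[X]).eval t) =ᶠ[𝓝 x]
      fun t => (1 : ℂ[X]).eval t := by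
    filter_upwards [isOpen_ne.mem_nhds h.symm] with t ht
    have : z - t ≠ 0 := sub_ne_zero.2 (Ne.symm ht)
    simp [this]
  rw [taylorSeries_congr h1, taylorSeries_polynomial]
  simp

end TaylorSeries

/-! ### Divided differences of polynomials -/

section DividedDifference

/-- The `l`-fold quotient of a polynomial by `X - x`. -/
def iterQuot (x : ℂ) (l : ℕ) (f : ℂ[X]) : ℂ[X] := (fun g => g /ₘ (X - C x))^[l] f

theorem iterQuot_succ (x : ℂ) (l : ℕ) (f : ℂ[X]) :
    iterQuot x (l + 1) f = iterQuot x l f /ₘ (X - C x) := Function.iterate_succ_apply' _ _ _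

theorem iterQuot_eq (x : ℂ) (l : ℕ) (f : ℂ[X]) :
    iterQuot x l f = C ((iterQuot x l f).eval x) + (X - C x) * iterQuot x (l + 1) f := by
  rw [iterQuot_succ, ← modByMonic_X_sub_C_eq_C_eval, modByMonic_add_div]

/-- Each division by X - x drops the constant Taylor coefficient at x and shifts the others. -/
theorem coeff_taylor_iterQuot (x : ℂ) (l n : ℕ) (f : ℂ[X]) :
    (taylor x (iterQuot x l f)).coeff n = (taylor x f).coeff (n + l) := by
  induction l generalizing n with
  | zero => rfl
  | succ l ih =>
    rw [← add_assoc, add_right_comm, ← ih, iterQuot_eq x l]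
    simp [taylor_mul, coeff_C_succ]

theorem coeff_iterQuot_eq_zero (x : ℂ) {l n : ℕ} {f : ℂ[X]} (h : f.natDegree < n + l) :
    (iterQuot x l f).coeff n = 0 := by
  refine coeff_eq_zero_of_degree_lt ?_
  rw [← degree_taylor _ x, degree_lt_iff_coeff_zero]
  intro k hk
  rw [coeff_taylor_iterQuot]
  exact coeff_eq_zero_of_natDegree_lt (by rw [natDegree_taylor]; omega)

theorem iterQuot_eq_zero (x : ℂ) {l : ℕ} {f : ℂ[X]} (h : f.natDegree < l) : iterQuot x l f = 0 := by
  ext n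
  rw [coeff_iterQuot_eq_zero x (by omega), coeff_zero]

/-- The sum telescopes: write z - X = (z - x) - (X - x) and use that X - x times one quotient is the
previous quotient minus its value at x. -/
theorem sub_mul_sum_iterQuot (x z : ℂ) (f : ℂ[X]) (M : ℕ) :
    (C z - X) * ∑ s ∈ Finset.range M, C ((z - x) ^ s) * iterQuot x (s + 1) f =
      ∑ s ∈ Finset.range M, C ((z - x) ^ s * (iterQuot x s f).eval x) - f +
        C ((z - x) ^ M) * iterQuot x M f := by
  induction M with
  | zero => simp [iterQuot]
  | succ M ih =>
    have h := iterQuot_eq x M f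
    rw [Finset.sum_range_succ, mul_add, ih, Finset.sum_range_succ]
    simp only [map_mul, map_pow, map_sub] at h ⊢
    linear_combination (C z - C x) ^ M * h

theorem eval_eq_sum_iterQuot (x z : ℂ) (f : ℂ[X]) (M : ℕ) (h : f.natDegree < M) :
    ∑ s ∈ Finset.range M, (z - x) ^ s * (iterQuot x s f).eval x = f.eval z := by
  have h1 := congrArg (eval z) (sub_mul_sum_iterQuot x z f M)
  rw [iterQuot_eq_zero x h] at h1
  simp only [eval_mul, eval_sub, eval_add, eval_C, eval_X, sub_self, zero_mul, eval_finsetSum,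
    mul_zero, eval_zero] at h1
  linear_combination -h1

/-- The expansion of the divided difference `(f(z) - f(t)) / (z - t)` in powers of `z - x`. -/
theorem sub_mul_sum_iterQuot_eq (x z : ℂ) {f : ℂ[X]} {M : ℕ} (h : f.natDegree < M) :
    (C z - X) * ∑ s ∈ Finset.range M, C ((z - x) ^ s) * iterQuot x (s + 1) f =
      C (f.eval z) - f := by
  rw [sub_mul_sum_iterQuot, iterQuot_eq_zero x h, ← map_sum, eval_eq_sum_iterQuot x z f M h,
    mul_zero, add_zero]

end DividedDifference

/-! ### Left Jordan chains and the masses -/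

namespace CanonicalJordanData

variable {p q : ℕ} {R : Matrix (Fin p) (Fin p) ℂ[X]} (J : CanonicalJordanData R)
  (ξ : (i : Fin J.M) → Fin (J.s i) → ℕ → Fin q → ℂ → ℂ)

/-- The left Jordan chain as a row of power series in `z - x_i`. -/
def leftSeries (i : Fin J.M) (j : Fin (J.s i)) (a : Fin p) : PowerSeries ℂ :=
  PowerSeries.mk fun m => J.vL i j m a

theorem coeff_mul_leftSeries (i : Fin J.M) (j : Fin (J.s i)) (Y : Fin p → PowerSeries ℂ) (k : ℕ) :
    PowerSeries.coeff k (∑ a, J.leftSeries i j a * Y a) =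
      ∑ l ∈ Finset.range (k + 1), ∑ a, J.vL i j (k - l) a * PowerSeries.coeff l (Y a) := by
  rw [map_sum, Finset.sum_comm]
  refine Finset.sum_congr rfl fun a _ => ?_
  rw [mul_comm, PowerSeries.coeff_mul, Finset.Nat.sum_antidiagonal_eq_sum_range_succ_mk]
  refine Finset.sum_congr rfl fun l _ => ?_
  rw [leftSeries, PowerSeries.coeff_mk, mul_comm]

theorem coeff_leftSeries_mul_taylor (i : Fin J.M) (j : Fin (J.s i)) (c : Fin p) {k : ℕ}
    (hk : k < J.κ i j) :
    PowerSeries.coeff k (∑ a, J.leftSeries i j a * (taylor (J.x i) (R a c) : PowerSeries ℂ)) =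
      0 := by
  have h := congrFun (J.left_chain i j k hk) c
  rw [Finset.sum_apply] at h
  rw [coeff_mul_leftSeries, ← Pi.zero_apply (M := fun _ => ℂ) c, ← h]
  refine Finset.sum_congr rfl fun l _ => ?_
  simp only [Polynomial.coeff_coe, coeff_taylor_eq, Pi.smul_apply, Matrix.vecMul, dotProduct,
    evalDeriv, Matrix.map_apply, smul_eq_mul, Finset.mul_sum]
  exact Finset.sum_congr rfl fun a _ => by ring

/-- A left Jordan chain annihilates the matrix polynomial to the order of its length. -/
theorem coeff_mul_leftSeries_eq_zero (i : Fin J.M) (j : Fin (J.s i)) {k : ℕ} (hk : k < J.κ i j)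
    (F : PowerSeries ℂ) (Y : Fin p → PowerSeries ℂ) :
    PowerSeries.coeff k (F * ∑ a, J.leftSeries i j a *
      ∑ c, (taylor (J.x i) (R a c) : PowerSeries ℂ) * Y c) = 0 := by
  have h : (PowerSeries.X : PowerSeries ℂ) ^ J.κ i j ∣ ∑ a, J.leftSeries i j a *
      ∑ c, (taylor (J.x i) (R a c) : PowerSeries ℂ) * Y c := by
    have h1 : ∑ a, J.leftSeries i j a * ∑ c, (taylor (J.x i) (R a c) : PowerSeries ℂ) * Y c =
        ∑ c, (∑ a, J.leftSeries i j a * (taylor (J.x i) (R a c) : PowerSeries ℂ)) * Y c := by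
      simp only [Finset.mul_sum, Finset.sum_mul]
      rw [Finset.sum_comm]
      exact Finset.sum_congr rfl fun c _ => Finset.sum_congr rfl fun a _ => by ring
    rw [h1]
    refine Finset.dvd_sum fun c _ => Dvd.dvd.mul_right ?_ _
    exact PowerSeries.X_pow_dvd_iff.2 fun m hm => J.coeff_leftSeries_mul_taylor i j c hm
  exact PowerSeries.X_pow_dvd_iff.1 (h.mul_left F) k hk

/-- The Taylor series of `P ξ_{i,j,k}` at `x_i`. -/
def weightSeries (i : Fin J.M) (j : Fin (J.s i)) (k : ℕ) (P : Fin q → ℂ[X]) : PowerSeries ℂ :=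
  ∑ b, (taylor (J.x i) (P b) : PowerSeries ℂ) * taylorSeries (ξ i j k b) (J.x i)

/-- The part of the perturbed pairing which is supported at `x_i`, as a bilinear form. -/
def massForm (i : Fin J.M) : (Fin q → ℂ[X]) →ₗ[ℂ] (Fin p → ℂ[X]) →ₗ[ℂ] ℂ :=
  LinearMap.mk₂ ℂ (fun P Q => ∑ j, ∑ k ∈ Finset.range (J.κ i j),
    PowerSeries.coeff k (J.weightSeries ξ i j k P *
      ∑ a, J.leftSeries i j a * (taylor (J.x i) (Q a) : PowerSeries ℂ)))
    (fun P P' Q => by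
      simp only [weightSeries, Pi.add_apply, map_add, Polynomial.coe_add, add_mul,
        Finset.sum_add_distrib])
    (fun c P Q => by
      simp only [weightSeries, Pi.smul_apply, map_smul, Polynomial.coe_smul, smul_mul_assoc,
        ← Finset.smul_sum])
    (fun P Q Q' => by
      simp only [Pi.add_apply, map_add, Polynomial.coe_add, mul_add, Finset.sum_add_distrib])
    (fun c P Q => by
      simp only [Pi.smul_apply, map_smul, Polynomial.coe_smul, mul_smul_comm,
        ← Finset.smul_sum])

theorem massForm_apply (i : Fin J.M) (P : Fin q → ℂ[X]) (Q : Fin p → ℂ[X]) :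
    J.massForm ξ i P Q = ∑ j, ∑ k ∈ Finset.range (J.κ i j),
      PowerSeries.coeff k (J.weightSeries ξ i j k P *
        ∑ a, J.leftSeries i j a * (taylor (J.x i) (Q a) : PowerSeries ℂ)) := rfl

/-- The factor Y is allowed to be a formal germ at x_i, so that columns R v / (x - x_{i'})^(k+1)
with i' ≠ i are covered as well as polynomial multiples of R. -/
theorem massForm_eq_zero (i : Fin J.M) (P : Fin q → ℂ[X]) {Q : Fin p → ℂ[X]}
    (Y : Fin p → PowerSeries ℂ) (h : ∀ a, (taylor (J.x i) (Q a) : PowerSeries ℂ) =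
      ∑ c, (taylor (J.x i) (R a c) : PowerSeries ℂ) * Y c) : J.massForm ξ i P Q = 0 := by
  rw [massForm_apply]
  refine Finset.sum_eq_zero fun j _ => Finset.sum_eq_zero fun k hk => ?_
  simp only [h]
  exact J.coeff_mul_leftSeries_eq_zero i j (Finset.mem_range.1 hk) _ _

theorem massForm_mulVec (i : Fin J.M) (P : Fin q → ℂ[X]) (Q : Fin p → ℂ[X]) :
    J.massForm ξ i P (R *ᵥ Q) = 0 := by
  refine J.massForm_eq_zero ξ i P (fun c => (taylor (J.x i) (Q c) : PowerSeries ℂ)) fun a => ?_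
  exact coe_taylor_sum_mul Finset.univ (fun c => R a c) Q (J.x i)

variable {ξ}

theorem analyticAt_weight {i : Fin J.M} {j : Fin (J.s i)} {k : ℕ}
    (hξ : ∀ b, AnalyticAt ℂ (ξ i j k b) (J.x i)) (P : Fin q → ℂ[X]) :
    AnalyticAt ℂ (fun z => ∑ b, (P b).eval z * ξ i j k b z) (J.x i) :=
  Finset.analyticAt_fun_sum _ fun b _ => (analyticAt_polynomial _ _).mul (hξ b)

theorem weightSeries_eq {i : Fin J.M} {j : Fin (J.s i)} {k : ℕ}
    (hξ : ∀ b, AnalyticAt ℂ (ξ i j k b) (J.x i)) (P : Fin q → ℂ[X]) :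
    J.weightSeries ξ i j k P = taylorSeries (fun z => ∑ b, (P b).eval z * ξ i j k b z) (J.x i) := by
  rw [taylorSeries_sum Finset.univ (f := fun b z => (P b).eval z * ξ i j k b z)
    fun b _ => (analyticAt_polynomial _ _).mul (hξ b), weightSeries]
  refine Finset.sum_congr rfl fun b _ => ?_
  rw [taylorSeries_mul (analyticAt_polynomial _ _) (hξ b), taylorSeries_polynomial]

/-- The sum over l is the Cauchy product of the chain, read as a series in z - x_i, with the Taylor
coefficients of the remaining factors. -/
theorem massForm_eq (hξ : ∀ i j k b, k < J.κ i j → AnalyticAt ℂ (ξ i j k b) (J.x i)) (i : Fin J.M)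
    (P : Fin q → ℂ[X]) (Q : Fin p → ℂ[X]) :
    ∑ j, ∑ k ∈ Finset.range (J.κ i j), ∑ l ∈ Finset.range (k + 1),
      (1 / (l ! : ℂ)) * iteratedDeriv l
        (fun z => (∑ b, (P b).eval z * ξ i j k b z) *
          ∑ a, J.vL i j (k - l) a * (Q a).eval z) (J.x i) = J.massForm ξ i P Q := by
  rw [massForm_apply]
  refine Finset.sum_congr rfl fun j _ => Finset.sum_congr rfl fun k hk => ?_
  have hξ' := fun b => hξ i j k b (Finset.mem_range.1 hk)
  rw [Finset.mul_sum, Finset.sum_congr rfl fun a _ => mul_left_comm _ _ _, coeff_mul_leftSeries]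
  refine Finset.sum_congr rfl fun l _ => ?_
  have h1 : (fun z => ∑ a, J.vL i j (k - l) a * (Q a).eval z) =
      fun z => (∑ a, C (J.vL i j (k - l) a) * Q a).eval z := by
    funext z
    simp [eval_finsetSum]
  rw [← coeff_taylorSeries, taylorSeries_mul (J.analyticAt_weight hξ' P)
    (by rw [h1]; exact analyticAt_polynomial _ _), h1, taylorSeries_polynomial,
    ← J.weightSeries_eq hξ' P]
  have h2 : ((taylor (J.x i) (∑ a, C (J.vL i j (k - l) a) * Q a) : ℂ[X]) : PowerSeries ℂ) =
      ∑ a, J.vL i j (k - l) a • (taylor (J.x i) (Q a) : PowerSeries ℂ) := by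
    rw [coe_taylor_sum_mul]
    simp [PowerSeries.smul_eq_C_mul]
  rw [h2, Finset.mul_sum, map_sum]
  refine Finset.sum_congr rfl fun a _ => ?_
  rw [mul_smul_comm, map_smul, smul_eq_mul]

/-- The rows transformed by the Cauchy kernel are polynomials in `z`. -/
theorem massTransform_eq (hξ : ∀ i j k b, k < J.κ i j → AnalyticAt ℂ (ξ i j k b) (J.x i))
    (i : Fin J.M) (P : Fin q → ℂ[X]) {M : ℕ} (hM : ∀ a c, (R a c).natDegree < M) {z : ℂ}
    (hz : z ≠ J.x i) (c : Fin p) :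
    massTransform J ξ P i z c = ∑ s ∈ Finset.range M, (z - J.x i) ^ s *
      J.massForm ξ i P fun a => iterQuot (J.x i) (s + 1) (R a c) := by
  have hlin : ∑ s ∈ Finset.range M, (z - J.x i) ^ s *
      J.massForm ξ i P (fun a => iterQuot (J.x i) (s + 1) (R a c)) =
      J.massForm ξ i P fun a => ∑ s ∈ Finset.range M,
        C ((z - J.x i) ^ s) * iterQuot (J.x i) (s + 1) (R a c) := by
    have : (fun a => ∑ s ∈ Finset.range M,
        C ((z - J.x i) ^ s) * iterQuot (J.x i) (s + 1) (R a c)) =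
        ∑ s ∈ Finset.range M, (z - J.x i) ^ s • fun a => iterQuot (J.x i) (s + 1) (R a c) := by
      funext a
      simp [Finset.sum_apply, smul_eq_C_mul]
    rw [this, map_sum]
    simp
  rw [hlin, massForm_apply, massTransform, Finset.sum_apply]
  refine Finset.sum_congr rfl fun j _ => ?_
  rw [Finset.sum_apply]
  refine Finset.sum_congr rfl fun k hk => ?_
  have hk' := Finset.mem_range.1 hk
  have hξ' := fun b => hξ i j k b hk'
  set I := taylorSeries (fun t => (z - t)⁻¹) (J.x i) with hI
  set W := J.weightSeries ξ i j k P with hW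
  have hts : ∀ l, (1 / (l ! : ℂ)) * iteratedDeriv l
      (fun t => (∑ b, (P b).eval t * ξ i j k b t) / (z - t)) (J.x i) =
      PowerSeries.coeff l (W * I) := by
    intro l
    simp only [div_eq_mul_inv (∑ b, _ : ℂ)]
    rw [← coeff_taylorSeries, taylorSeries_mul (J.analyticAt_weight hξ' P)
      (analyticAt_sub_inv hz), hW, J.weightSeries_eq hξ' P]
  set E : Fin p → ℂ[X] := fun a => ∑ s ∈ Finset.range M,
    C ((z - J.x i) ^ s) * iterQuot (J.x i) (s + 1) (R a c) with hE
  have hIE : ∀ a, (taylor (J.x i) (E a) : PowerSeries ℂ) =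
      I * PowerSeries.C ((R a c).eval z) - I * (taylor (J.x i) (R a c) : PowerSeries ℂ) := by
    intro a
    have h1 := sub_mul_sum_iterQuot_eq (J.x i) z (hM a c)
    have h2 := congrArg (fun f => ((taylor (J.x i) f : ℂ[X]) : PowerSeries ℂ)) h1
    simp only [taylor_mul, Polynomial.coe_mul, map_sub (taylor (J.x i)), taylor_C,
      Polynomial.coe_sub, Polynomial.coe_C] at h2
    have h3 := taylorSeries_sub_inv_mul hz
    rw [map_sub, taylor_C, Polynomial.coe_sub, Polynomial.coe_C, ← hI] at h3
    rw [← mul_sub, ← h2, ← mul_assoc, h3, one_mul]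
  -- In the divided difference (R(z) - R(t)) / (z - t) the term with R(t) is killed by the left
  -- chain, whatever the weight and the kernel; only R(z) / (z - t) contributes.
  have hzero : PowerSeries.coeff k (W * I * ∑ a, J.leftSeries i j a *
      (taylor (J.x i) (R a c) : PowerSeries ℂ)) = 0 := by
    have := J.coeff_mul_leftSeries_eq_zero i j hk' (W * I) (Pi.single c 1)
    simpa [Pi.single_apply] using this
  have hsplit : W * ∑ a, J.leftSeries i j a * (taylor (J.x i) (E a) : PowerSeries ℂ) =
      ∑ a, J.leftSeries i j a * ((R a c).eval z • (W * I)) -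
        W * I * ∑ a, J.leftSeries i j a * (taylor (J.x i) (R a c) : PowerSeries ℂ) := by
    simp only [Finset.mul_sum]
    rw [← Finset.sum_sub_distrib]
    refine Finset.sum_congr rfl fun a _ => ?_
    rw [hIE, PowerSeries.smul_eq_C_mul]
    ring
  rw [hsplit, map_sub, hzero, sub_zero, coeff_mul_leftSeries, Finset.sum_apply]
  refine Finset.sum_congr rfl fun l _ => ?_
  rw [Pi.smul_apply, hts, smul_eq_mul, Matrix.vecMul, dotProduct, Finset.mul_sum]
  refine Finset.sum_congr rfl fun a _ => ?_
  simp only [evalDeriv, Matrix.map_apply, Function.iterate_zero, id, map_smul, smul_eq_mul]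
  ring

end CanonicalJordanData

/-! ### Right Jordan chains and the polynomial columns attached to them -/

namespace CanonicalJordanData

variable {p q : ℕ} {R : Matrix (Fin p) (Fin p) ℂ[X]} (J : CanonicalJordanData R)
  {ξ : (i : Fin J.M) → Fin (J.s i) → ℕ → Fin q → ℂ → ℂ}

/-- The truncated right Jordan chain `∑_{m ≤ k} v^R_{i,j;m} (t - x_i)^m`. -/
def rightPoly (u : J.Index) (c : Fin p) : ℂ[X] :=
  ∑ m ∈ Finset.range (u.2.2.val + 1), C (J.vR u.1 u.2.1 m c) * (X - C (J.x u.1)) ^ m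

/-- The polynomial column `R(t) v(t) / (t - x_i)^(k+1)`, where `v` is a truncated right Jordan
chain. -/
def jordanColumn (u : J.Index) : Fin p → ℂ[X] :=
  ∑ l ∈ Finset.range (u.2.2.val + 1), ∑ c, J.vR u.1 u.2.1 (u.2.2 - l) c •
    fun a => iterQuot (J.x u.1) (l + 1) (R a c)

theorem jordanColumn_apply (u : J.Index) (a : Fin p) :
    J.jordanColumn u a = ∑ l ∈ Finset.range (u.2.2.val + 1), ∑ c,
      J.vR u.1 u.2.1 (u.2.2 - l) c • iterQuot (J.x u.1) (l + 1) (R a c) := by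
  simp [jordanColumn, Finset.sum_apply]

theorem coeff_taylor_rightPoly (u : J.Index) (a : Fin p) (n : ℕ) :
    (taylor (J.x u.1) (∑ c, R a c * J.rightPoly u c)).coeff n =
      ∑ m ∈ Finset.range (u.2.2.val + 1), if m ≤ n then
        ∑ c, J.vR u.1 u.2.1 m c * (taylor (J.x u.1) (R a c)).coeff (n - m) else 0 := by
  rw [map_sum, finsetSum_coeff]
  simp only [rightPoly, Finset.mul_sum, map_sum, finsetSum_coeff]
  rw [Finset.sum_comm]
  refine Finset.sum_congr rfl fun m _ => ?_
  have h : ∀ c, (taylor (J.x u.1) (R a c * (C (J.vR u.1 u.2.1 m c) *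
      (X - C (J.x u.1)) ^ m))).coeff n = if m ≤ n then
        J.vR u.1 u.2.1 m c * (taylor (J.x u.1) (R a c)).coeff (n - m) else 0 := by
    intro c
    rw [← mul_assoc, taylor_mul, taylor_mul, taylor_pow, map_sub, taylor_X, taylor_C,
      taylor_C, add_sub_cancel_right, coeff_mul_X_pow', coeff_mul_C, mul_comm]
  simp only [h]
  split_ifs <;> simp

/-- Compare Taylor coefficients at x_i: up to order k those of R v vanish by the right chain
condition, and beyond that both sides are the same shifted convolution. -/
theorem mul_jordanColumn (u : J.Index) (a : Fin p) :
    (X - C (J.x u.1)) ^ (u.2.2.val + 1) * J.jordanColumn u a = (R *ᵥ J.rightPoly u) a := by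
  refine taylor_injective (J.x u.1) ?_
  ext n
  rw [Matrix.mulVec, dotProduct, coeff_taylor_rightPoly, taylor_mul, taylor_pow, map_sub, taylor_X,
    taylor_C, add_sub_cancel_right, coeff_X_pow_mul']
  by_cases hn : u.2.2.val + 1 ≤ n
  · rw [if_pos hn, jordanColumn_apply, map_sum, finsetSum_coeff, ← Finset.sum_range_reflect]
    refine Finset.sum_congr rfl fun l hl => ?_
    have hl' := Finset.mem_range.1 hl
    rw [if_pos (by omega), map_sum, finsetSum_coeff]
    refine Finset.sum_congr rfl fun c _ => ?_
    rw [map_smul, coeff_smul, coeff_taylor_iterQuot, smul_eq_mul]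
    rw [show u.2.2.val - (u.2.2.val + 1 - 1 - l) = l by omega,
      show n - (u.2.2.val + 1) + (u.2.2.val + 1 - 1 - l + 1) = n - l by omega]
  · rw [if_neg hn]
    have hn' : n ≤ u.2.2.val := by omega
    have h := congrFun (J.right_chain u.1 u.2.1 n (hn'.trans_lt u.2.2.2)) a
    rw [Finset.sum_apply, ← Finset.sum_range_reflect] at h
    have hsub : Finset.range (n + 1) ⊆ Finset.range (u.2.2.val + 1) :=
      Finset.range_mono (by omega)
    symm
    rw [← Finset.sum_subset hsub]
    · refine Eq.trans (Finset.sum_congr rfl fun m hm => ?_) h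
      have hm' := Nat.lt_succ_iff.1 (Finset.mem_range.1 hm)
      rw [if_pos hm', Pi.smul_apply, Matrix.mulVec, dotProduct, smul_eq_mul, Finset.mul_sum]
      refine Finset.sum_congr rfl fun c _ => ?_
      rw [show n - (n + 1 - 1 - m) = m by omega, show n + 1 - 1 - m = n - m by omega,
        coeff_taylor_eq, evalDeriv, Matrix.map_apply]
      ring
    · intro m _ hm
      rw [if_neg]
      simpa [Nat.lt_succ_iff] using hm

/-- The quotients lower degrees by at least one. Degree N occurs in R only at c = a + r, hence only
in rows a < p - r, so the largest possible step index is (N - 1)p + p - r - 1. -/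
theorem stepLT_jordanColumn [NeZero p] {N r : ℕ} (hR : LeadingCondition N r R) (hN : 0 < N)
    (hr : r < p) (u : J.Index) : StepLT (J.jordanColumn u) (N * p - r) := by
  intro k hk
  obtain ⟨l, a, rfl⟩ := exists_step_index p k
  have ha := a.2
  rw [stepCoeff_mul_add, jordanColumn_apply, finsetSum_coeff]
  refine Finset.sum_eq_zero fun s _ => ?_
  rw [finsetSum_coeff]
  refine Finset.sum_eq_zero fun c _ => ?_
  rw [coeff_smul, coeff_iterQuot_eq_zero, smul_zero]
  have hle := hR.degree_le a c
  have hlN : N ≤ l + 1 := by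
    by_contra h
    have := Nat.mul_le_mul_right p (show l + 2 ≤ N by omega)
    rw [add_mul] at this
    omega
  rcases hle.lt_or_eq with h | h
  · omega
  · have h1 := hR.leading a c
    have hc := c.2
    by_cases hca : (c : ℕ) = a + r
    · suffices N ≤ l by omega
      by_contra h2
      have h3 : N = l + 1 := by omega
      rw [h3, add_mul] at hk
      omega
    · rw [if_neg hca, ← h, coeff_natDegree, leadingCoeff_eq_zero] at h1
      rw [h1, natDegree_zero] at h
      omega

/-- Away from its own eigenvalue, (x - x_{i'})^(-(k+1)) is an invertible germ, so the column is R
times a germ. -/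
theorem massForm_jordanColumn_of_ne (P : Fin q → ℂ[X]) (u : J.Index) {i : Fin J.M}
    (hi : i ≠ u.1) : J.massForm ξ i P (J.jordanColumn u) = 0 := by
  have hx : J.x u.1 ≠ J.x i := fun h => hi (J.x_injective h).symm
  set I := taylorSeries (fun t => (J.x u.1 - t)⁻¹) (J.x i) with hI
  have h3 := taylorSeries_sub_inv_mul hx
  rw [← hI] at h3
  refine J.massForm_eq_zero ξ i P (fun c => (-I) ^ (u.2.2.val + 1) *
    (taylor (J.x i) (J.rightPoly u c) : PowerSeries ℂ)) fun a => ?_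
  have h1 := congrArg (fun f => ((taylor (J.x i) f : ℂ[X]) : PowerSeries ℂ))
    (J.mul_jordanColumn u a)
  rw [Matrix.mulVec, dotProduct, coe_taylor_sum_mul, taylor_mul, taylor_pow, Polynomial.coe_mul,
    Polynomial.coe_pow] at h1
  have h5 : (-I) * ((taylor (J.x i) (X - C (J.x u.1)) : ℂ[X]) : PowerSeries ℂ) = 1 := by
    rw [← neg_sub (C (J.x u.1)) X, map_neg, Polynomial.coe_neg, neg_mul_neg, h3]
  rw [Finset.sum_congr rfl fun c _ => mul_left_comm _ _ _, ← Finset.mul_sum, ← h1, ← mul_assoc,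
    ← mul_pow, h5, one_pow, one_mul]

/-- The entries of `𝕎` are the masses of the Jordan columns. -/
theorem bbW_eq (hξ : ∀ i j k b, k < J.κ i j → AnalyticAt ℂ (ξ i j k b) (J.x i))
    (P : Fin q → ℂ[X]) (u : J.Index) :
    bbW J ξ P u = J.massForm ξ u.1 P (J.jordanColumn u) := by
  obtain ⟨M, hM, hkM⟩ : ∃ M, (∀ a c, (R a c).natDegree < M) ∧ u.2.2.val < M := by
    refine ⟨∑ a, ∑ c, (R a c).natDegree + u.2.2.val + 1, fun a c => ?_, by omega⟩
    have h1 := Finset.single_le_sum (f := fun a => ∑ c, (R a c).natDegree)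
      (fun _ _ => Nat.zero_le _) (Finset.mem_univ a)
    have h2 := Finset.single_le_sum (f := fun c => (R a c).natDegree)
      (fun _ _ => Nat.zero_le _) (Finset.mem_univ c)
    omega
  set m : ℕ → Fin p → ℂ := fun s c =>
    J.massForm ξ u.1 P fun a => iterQuot (J.x u.1) (s + 1) (R a c) with hm
  set S : Fin p → ℂ[X] := fun c => ∑ s ∈ Finset.range M, C (m s c) * (X - C (J.x u.1)) ^ s with hS
  have hSeval : ∀ z, z ≠ J.x u.1 → ∀ c, massTransform J ξ P u.1 z c = (S c).eval z := by
    intro z hz c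
    rw [J.massTransform_eq hξ u.1 P hM hz, hS]
    simp [eval_finsetSum, hm, mul_comm]
  have hScoeff : ∀ c l, l < M → (1 / (l ! : ℂ)) * (derivative^[l] (S c)).eval (J.x u.1) = m l c := by
    intro c l hl
    rw [← coeff_taylor_eq, hS, map_sum, finsetSum_coeff, Finset.sum_eq_single l]
    · simp [taylor_mul, taylor_pow]
    · intro s _ hs
      simp [taylor_mul, taylor_pow, coeff_X_pow, hs.symm]
    · simp [hl]
  set F : ℂ → ℂ := fun z => ∑ l ∈ Finset.range (u.2.2.val + 1), (1 / (l ! : ℂ)) *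
    ∑ c, (derivative^[l] (S c)).eval z * J.vR u.1 u.2.1 (u.2.2 - l) c with hF
  have hFc : Continuous F := by
    rw [hF]
    exact continuous_finsetSum _ fun l _ => continuous_const.mul
      (continuous_finsetSum _ fun c _ => (Polynomial.continuous _).mul continuous_const)
  -- The transform agrees with the polynomial row S only for z ≠ x_i, so derivatives are compared on
  -- the punctured neighbourhood and the limit comes from continuity of F.
  have hlim : Tendsto (fun z => ∑ l ∈ Finset.range (u.2.2.val + 1), (1 / (l ! : ℂ)) *
      ∑ a, iteratedDeriv l (fun y => massTransform J ξ P u.1 y a) z *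
        J.vR u.1 u.2.1 (u.2.2 - l) a) (𝓝[≠] J.x u.1) (𝓝 (F (J.x u.1))) := by
    refine (hFc.continuousWithinAt (s := {J.x u.1}ᶜ)).congr' ?_
    filter_upwards [self_mem_nhdsWithin] with z hz
    rw [hF]
    refine Finset.sum_congr rfl fun l _ => ?_
    congr 1
    refine Finset.sum_congr rfl fun c _ => ?_
    congr 1
    rw [← congrFun (iteratedDeriv_polynomial (S c) l) z]
    refine EventuallyEq.iteratedDeriv_eq l ?_
    filter_upwards [isOpen_ne.mem_nhds hz] with y hy
    exact (hSeval y hy c).symm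
  rw [bbW, hlim.limUnder_eq, jordanColumn, map_sum, hF]
  refine Finset.sum_congr rfl fun l hl => ?_
  have hl' := Finset.mem_range.1 hl
  rw [map_sum, Finset.mul_sum]
  refine Finset.sum_congr rfl fun c _ => ?_
  rw [map_smul, smul_eq_mul, ← mul_assoc, hScoeff c l (by omega), mul_comm]

end CanonicalJordanData

/-! ### Integrals against complex measures and Cauchy transforms -/

section Integral

/-- Since |D| tends to infinity, it attains its minimum on the closed, possibly unbounded, set Δ.
This makes 1 / det R and the Cauchy kernels bounded on the support. -/
theorem exists_le_norm_eval {Δ : Set ℝ} (hΔ : IsClosed Δ) {D : ℂ[X]} (hD : 0 < D.degree)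
    (h : ∀ t ∈ Δ, D.eval (t : ℂ) ≠ 0) : ∃ ε > 0, ∀ t ∈ Δ, ε ≤ ‖D.eval (t : ℂ)‖ := by
  rcases Δ.eq_empty_or_nonempty with rfl | ⟨x₀, hx₀⟩
  · exact ⟨1, one_pos, by simp⟩
  · have hlim : Tendsto (fun t : ℝ => ‖D.eval (t : ℂ)‖) (cocompact ℝ) atTop :=
      D.tendsto_norm_atTop hD (by
        simp only [Complex.norm_real]
        exact tendsto_norm_cocompact_atTop)
    have hc : Continuous fun t : ℝ => ‖D.eval (t : ℂ)‖ :=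
      (D.continuous.comp Complex.continuous_ofReal).norm
    obtain ⟨y, hy, hmin⟩ := hc.continuousOn.exists_isMinOn' hΔ hx₀
      ((hlim.eventually_ge_atTop _).filter_mono inf_le_left)
    exact ⟨_, norm_pos_iff.2 (h y hy), fun t ht => hmin ht⟩

variable {ν : ComplexMeasure ℝ} {f g : ℝ → ℂ}

theorem cintegral_add (hf : ν.Integrable f) (hg : ν.Integrable g) :
    cintegral ν (fun t => f t + g t) = cintegral ν f + cintegral ν g :=
  VectorMeasure.integral_fun_add hf hg

theorem cintegral_sum {ι : Type*} (s : Finset ι) {F : ι → ℝ → ℂ}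
    (hF : ∀ i ∈ s, ν.Integrable (F i)) :
    cintegral ν (fun t => ∑ i ∈ s, F i t) = ∑ i ∈ s, cintegral ν (F i) :=
  VectorMeasure.integral_finsetSum s hF

theorem cintegral_const_mul (c : ℂ) (f : ℝ → ℂ) :
    cintegral ν (fun t => c * f t) = c * cintegral ν f :=
  setToFun_smul (dominatedFinMeasAdditive_cbmApplyMeasure ν (ContinuousLinearMap.mul ℝ ℂ))
    (fun c s x => mul_assoc c x (ν s)) c f

theorem cintegral_congr {Δ : Set ℝ} (hsupp : ν.variation Δᶜ = 0) (h : ∀ t ∈ Δ, f t = g t) :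
    cintegral ν f = cintegral ν g :=
  VectorMeasure.integral_congr_ae
    ((measure_eq_zero_iff_ae_notMem.1 hsupp).mono fun t ht => h t (not_not.1 ht))

theorem ae_mem {Δ : Set ℝ} (hsupp : ν.variation Δᶜ = 0) : ∀ᵐ t ∂ν.variation, t ∈ Δ :=
  (measure_eq_zero_iff_ae_notMem.1 hsupp).mono fun _ ht => not_not.1 ht

theorem integrable_eval (hmom : ∀ k : ℕ, ν.Integrable fun t : ℝ => (t : ℂ) ^ k) (S : ℂ[X]) :
    ν.Integrable fun t : ℝ => S.eval (t : ℂ) := by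
  simp only [eval_eq_sum_range]
  exact integrable_finsetSum _ fun k _ => (hmom k).const_mul _

theorem integrable_mul_inv {Δ : Set ℝ} (hsupp : ν.variation Δᶜ = 0) (hf : ν.Integrable f)
    {D : ℂ[X]} {ε : ℝ} (hε : 0 < ε) (h : ∀ t ∈ Δ, ε ≤ ‖D.eval (t : ℂ)‖) :
    ν.Integrable fun t : ℝ => f t * (D.eval (t : ℂ))⁻¹ := by
  refine Integrable.mul_bdd (c := ε⁻¹) hf ?_ ?_
  · have : Measurable fun t : ℝ => D.eval (t : ℂ) :=
      (D.continuous.comp Complex.continuous_ofReal).measurable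
    exact this.inv.aestronglyMeasurable
  · filter_upwards [ae_mem hsupp] with t ht
    rw [norm_inv]
    exact inv_anti₀ hε (h t ht)

theorem hasDerivAt_sub_pow_inv {z w : ℂ} (h : z - w ≠ 0) (m : ℕ) :
    HasDerivAt (fun z => ((z - w) ^ m)⁻¹) (-m * ((z - w) ^ (m + 1))⁻¹) z := by
  have h1 := (((hasDerivAt_id z).sub_const w).pow m).inv (pow_ne_zero m h)
  refine h1.congr_deriv ?_
  rcases m with _ | m
  · simp
  · simp only [id, Nat.add_sub_cancel, Pi.pow_apply]
    field_simp
    ring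

theorem integrable_mul_sub_pow_inv {Δ : Set ℝ} (hsupp : ν.variation Δᶜ = 0) (hf : ν.Integrable f)
    {z : ℂ} {ε : ℝ} (hε : 0 < ε) (h : ∀ t ∈ Δ, ε ≤ ‖z - (t : ℂ)‖) (m : ℕ) :
    ν.Integrable fun t : ℝ => f t * ((z - (t : ℂ)) ^ m)⁻¹ := by
  have := integrable_mul_inv (D := (C z - X) ^ m) hsupp hf (pow_pos hε m) fun t ht => by
    simpa using pow_le_pow_left₀ hε.le (h t ht) m
  simpa using this

theorem exists_le_norm_sub {Δ : Set ℝ} (hΔ : IsClosed Δ) {z : ℂ} (hz : ∀ t ∈ Δ, z ≠ (t : ℂ)) :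
    ∃ ε > 0, ∀ t ∈ Δ, ε ≤ ‖z - (t : ℂ)‖ := by
  obtain ⟨ε, hε, h⟩ := exists_le_norm_eval (D := X - C z) hΔ (by simp)
    fun t ht => by simpa [sub_eq_zero] using (hz t ht).symm
  exact ⟨ε, hε, fun t ht => by simpa [norm_sub_rev] using h t ht⟩

/-- Differentiation of the Cauchy transform under the integral. -/
theorem hasDerivAt_cintegral {Δ : Set ℝ} (hΔ : IsClosed Δ) (hsupp : ν.variation Δᶜ = 0)
    (hf : ν.Integrable f) {z₀ : ℂ} (hz : ∀ t ∈ Δ, z₀ ≠ (t : ℂ)) (m : ℕ) :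
    HasDerivAt (fun z => cintegral ν fun t => f t * ((z - (t : ℂ)) ^ m)⁻¹)
      (-m * cintegral ν fun t => f t * ((z₀ - (t : ℂ)) ^ (m + 1))⁻¹) z₀ := by
  obtain ⟨ε, hε, h⟩ := exists_le_norm_sub hΔ hz
  have hε2 : 0 < ε / 2 := half_pos hε
  have hball : ∀ z ∈ Metric.ball z₀ (ε / 2), ∀ t ∈ Δ, ε / 2 ≤ ‖z - (t : ℂ)‖ := by
    intro z hzb t ht
    have h1 := h t ht
    have h2 : ‖z₀ - (t : ℂ)‖ ≤ ‖z₀ - z‖ + ‖z - (t : ℂ)‖ := by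
      simpa using norm_add_le (z₀ - z) (z - (t : ℂ))
    rw [Metric.mem_ball, dist_comm, dist_eq_norm] at hzb
    linarith
  have hz₀ := Metric.mem_ball_self (x := z₀) hε2
  have hint : ∀ z ∈ Metric.ball z₀ (ε / 2), ν.Integrable fun t : ℝ =>
      f t * ((z - (t : ℂ)) ^ m)⁻¹ := fun z hzb =>
    integrable_mul_sub_pow_inv hsupp hf hε2 (hball z hzb) m
  have hslope : ∀ z ∈ Metric.ball z₀ (ε / 2),
      slope (fun z => cintegral ν fun t => f t * ((z - (t : ℂ)) ^ m)⁻¹) z₀ z =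
        cintegral ν fun t => f t * slope (fun z => ((z - (t : ℂ)) ^ m)⁻¹) z₀ z := by
    intro z hzb
    simp only [slope_def_field]
    have h1 : cintegral ν (fun t => f t * ((z - (t : ℂ)) ^ m)⁻¹ - f t * ((z₀ - (t : ℂ)) ^ m)⁻¹) =
      _ := VectorMeasure.integral_fun_sub (hint z hzb) (hint z₀ hz₀)
    have h2 : (fun t : ℝ => f t * ((((z - (t : ℂ)) ^ m)⁻¹ - ((z₀ - (t : ℂ)) ^ m)⁻¹) / (z - z₀))) =
        fun t : ℝ => (z - z₀)⁻¹ *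
          (f t * ((z - (t : ℂ)) ^ m)⁻¹ - f t * ((z₀ - (t : ℂ)) ^ m)⁻¹) := by
      funext t
      ring
    rw [h2, cintegral_const_mul, h1, div_eq_inv_mul]
    rfl
  rw [hasDerivAt_iff_tendsto_slope]
  have hnear : ∀ᶠ z in 𝓝[≠] z₀, z ∈ Metric.ball z₀ (ε / 2) :=
    eventually_nhdsWithin_of_eventually_nhds (Metric.ball_mem_nhds z₀ hε2)
  have hlim : cintegral ν (fun t => f t * (-m * ((z₀ - (t : ℂ)) ^ (m + 1))⁻¹)) =
      -m * cintegral ν fun t => f t * ((z₀ - (t : ℂ)) ^ (m + 1))⁻¹ := by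
    rw [← cintegral_const_mul]
    congr 1
    funext t
    ring
  rw [← hlim]
  refine Tendsto.congr' (hnear.mono fun z hzb => (hslope z hzb).symm) ?_
  -- The majorant comes from the mean value inequality on the ball of radius ε/2, where every point
  -- is at distance at least ε/2 from Δ.
  refine VectorMeasure.tendsto_integral_filter_of_dominated_convergence
    (fun t => ‖f t‖ * (m * ((ε / 2) ^ (m + 1))⁻¹)) ?_ ?_ (hf.norm.mul_const _) ?_
  · refine hnear.mono fun z hzb => ?_
    have h2 : (fun t : ℝ => f t * slope (fun z => ((z - (t : ℂ)) ^ m)⁻¹) z₀ z) =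
        fun t : ℝ => (z - z₀)⁻¹ *
          (f t * ((z - (t : ℂ)) ^ m)⁻¹ - f t * ((z₀ - (t : ℂ)) ^ m)⁻¹) := by
      funext t
      rw [slope_def_field]
      ring
    rw [h2]
    exact (((hint z hzb).sub (hint z₀ hz₀)).const_mul _).aestronglyMeasurable
  · filter_upwards [hnear, self_mem_nhdsWithin] with z hzb hzne
    filter_upwards [ae_mem hsupp] with t ht
    rw [norm_mul]
    refine mul_le_mul_of_nonneg_left ?_ (norm_nonneg _)
    have hne : ∀ y ∈ Metric.ball z₀ (ε / 2), y - (t : ℂ) ≠ 0 := fun y hy =>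
      norm_pos_iff.1 (hε2.trans_le (hball y hy t ht))
    have h3 := Convex.norm_image_sub_le_of_norm_hasDerivWithin_le
      (C := m * ((ε / 2) ^ (m + 1))⁻¹)
      (fun y hy => (hasDerivAt_sub_pow_inv (hne y hy) m).hasDerivWithinAt)
      (fun y hy => by
        rw [norm_mul, norm_neg, norm_inv, norm_pow, Complex.norm_natCast]
        exact mul_le_mul_of_nonneg_left (inv_anti₀ (pow_pos hε2 _)
          (pow_le_pow_left₀ hε2.le (hball y hy t ht) _)) (Nat.cast_nonneg m))
      (convex_ball z₀ (ε / 2)) hz₀ hzb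
    rw [slope_def_field, norm_div]
    exact div_le_of_le_mul₀ (norm_nonneg _)
      (mul_nonneg (Nat.cast_nonneg m) (inv_nonneg.2 (pow_pos hε2 _).le)) h3
  · filter_upwards [ae_mem hsupp] with t ht
    exact (hasDerivAt_iff_tendsto_slope.1
      (hasDerivAt_sub_pow_inv (sub_ne_zero.2 (hz t ht)) m)).const_mul (f t)

theorem isOpen_forall_ne {Δ : Set ℝ} (hΔ : IsClosed Δ) :
    IsOpen {z : ℂ | ∀ t ∈ Δ, z ≠ (t : ℂ)} := by
  have : {z : ℂ | ∀ t ∈ Δ, z ≠ (t : ℂ)} = (Complex.ofReal '' Δ)ᶜ := by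
    ext z
    simp [eq_comm]
  rw [this]
  exact (Complex.isometry_ofReal.isClosedEmbedding.isClosedMap _ hΔ).isOpen_compl

theorem analyticAt_cintegral {Δ : Set ℝ} (hΔ : IsClosed Δ) (hsupp : ν.variation Δᶜ = 0)
    (hf : ν.Integrable f) {z₀ : ℂ} (hz : ∀ t ∈ Δ, z₀ ≠ (t : ℂ)) :
    AnalyticAt ℂ (fun z => cintegral ν fun t => f t / (z - (t : ℂ))) z₀ := by
  refine DifferentiableOn.analyticAt (s := {z : ℂ | ∀ t ∈ Δ, z ≠ (t : ℂ)}) (fun z hz' => ?_)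
    ((isOpen_forall_ne hΔ).mem_nhds hz)
  have := (hasDerivAt_cintegral hΔ hsupp hf hz' 1).differentiableAt.differentiableWithinAt
    (s := {z : ℂ | ∀ t ∈ Δ, z ≠ (t : ℂ)})
  simpa only [pow_one, div_eq_mul_inv] using this

/-- The derivatives of the Cauchy transform off the support. -/
theorem iteratedDeriv_cintegral {Δ : Set ℝ} (hΔ : IsClosed Δ) (hsupp : ν.variation Δᶜ = 0)
    (hf : ν.Integrable f) {z₀ : ℂ} (hz : ∀ t ∈ Δ, z₀ ≠ (t : ℂ)) (l : ℕ) :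
    iteratedDeriv l (fun z => cintegral ν fun t => f t / (z - (t : ℂ))) z₀ =
      (-1) ^ l * l ! * cintegral ν fun t => f t * ((z₀ - (t : ℂ)) ^ (l + 1))⁻¹ := by
  induction l generalizing z₀ with
  | zero => simp [div_eq_mul_inv]
  | succ l ih =>
    have h1 : iteratedDeriv l (fun z => cintegral ν fun t => f t / (z - (t : ℂ))) =ᶠ[𝓝 z₀]
        fun z => (-1) ^ l * l ! * cintegral ν fun t => f t * ((z - (t : ℂ)) ^ (l + 1))⁻¹ := by
      filter_upwards [(isOpen_forall_ne hΔ).mem_nhds hz] with z hz'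
      exact ih hz'
    rw [iteratedDeriv_succ, h1.deriv_eq,
      ((hasDerivAt_cintegral hΔ hsupp hf hz (l + 1)).const_mul _).deriv, Nat.factorial_succ]
    push_cast
    ring

/-- The integral of the polynomial multiples of a weight, as a linear map. -/
def polyIntegral (ν : ComplexMeasure ℝ) (h : ℝ → ℂ)
    (hint : ∀ S : ℂ[X], ν.Integrable fun t : ℝ => S.eval (t : ℂ) * h t) : ℂ[X] →ₗ[ℂ] ℂ where
  toFun S := cintegral ν fun t => S.eval (t : ℂ) * h t
  map_add' S T := by
    simp only [eval_add, add_mul]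
    exact cintegral_add (hint S) (hint T)
  map_smul' c S := by
    simp only [eval_smul, smul_eq_mul, mul_assoc, RingHom.id_apply]
    exact cintegral_const_mul c _

/-- The bilinear form `∑_{b,c} I_{b,c} (P_b Q_c)` of a matrix of functionals. -/
def functionalForm {p q : ℕ} (I : Fin q → Fin p → ℂ[X] →ₗ[ℂ] ℂ) :
    (Fin q → ℂ[X]) →ₗ[ℂ] (Fin p → ℂ[X]) →ₗ[ℂ] ℂ :=
  LinearMap.mk₂ ℂ (fun P Q => ∑ b, ∑ c, I b c (P b * Q c))
    (fun P P' Q => by simp only [Pi.add_apply, add_mul, map_add, Finset.sum_add_distrib])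
    (fun c P Q => by
      simp only [Pi.smul_apply, smul_mul_assoc, map_smul, ← Finset.smul_sum])
    (fun P Q Q' => by simp only [Pi.add_apply, mul_add, map_add, Finset.sum_add_distrib])
    (fun c P Q => by
      simp only [Pi.smul_apply, mul_smul_comm, map_smul, ← Finset.smul_sum])

theorem functionalForm_apply {p q : ℕ} (I : Fin q → Fin p → ℂ[X] →ₗ[ℂ] ℂ) (P : Fin q → ℂ[X])
    (Q : Fin p → ℂ[X]) : functionalForm I P Q = ∑ b, ∑ c, I b c (P b * Q c) := rfl

end Integral

/-! ### The perturbed pairing as a bilinear form, and the τ-determinants -/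

section Main

variable {p q : ℕ} {R : Matrix (Fin p) (Fin p) ℂ[X]}

/-- Cramer's rule turns dμ R⁻¹ into polynomials against the single weight 1 / det R. At zeros of det
R both sides take the default value 0. -/
theorem inv_evalDeriv_zero (R : Matrix (Fin p) (Fin p) ℂ[X]) (z : ℂ) (c a : Fin p) :
    (evalDeriv R 0 z)⁻¹ c a = (R.det.eval z)⁻¹ * (R.adjugate c a).eval z := by
  have h : evalDeriv R 0 z = (evalRingHom z).mapMatrix R := rfl
  rw [h, Matrix.inv_def, ← RingHom.map_adjugate, ← RingHom.map_det, Ring.inverse_eq_inv']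
  rfl

variable {Δ : Set ℝ} {μ : Fin q → Fin p → ComplexMeasure ℝ}

theorem measurePairing_eq
    (h0 : ∀ b a (S : ℂ[X]), (μ b a).Integrable fun t : ℝ => S.eval (t : ℂ) * 1)
    (P : Fin q → ℂ[X]) (Q : Fin p → ℂ[X]) :
    measurePairing μ P Q = functionalForm (fun b a => polyIntegral (μ b a) (fun _ => 1) (h0 b a))
      P Q := by
  rw [measurePairing, functionalForm_apply]
  refine Finset.sum_congr rfl fun b _ => Finset.sum_congr rfl fun a _ => ?_
  simp [polyIntegral]

variable (h1 : ∀ b a (S : ℂ[X]),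
    (μ b a).Integrable fun t : ℝ => S.eval (t : ℂ) * (R.det.eval (t : ℂ))⁻¹)
  (J : CanonicalJordanData R)
  (ξ : (i : Fin J.M) → Fin (J.s i) → ℕ → Fin q → ℂ → ℂ)

/-- The pairing of `dμ R⁻¹`, as a bilinear form. -/
def quotientForm : (Fin q → ℂ[X]) →ₗ[ℂ] (Fin p → ℂ[X]) →ₗ[ℂ] ℂ :=
  (functionalForm fun b a => polyIntegral (μ b a) (fun t => (R.det.eval (t : ℂ))⁻¹) (h1 b a)).compl₂
    (mulVecMap R.adjugate)

theorem quotientForm_apply (P : Fin q → ℂ[X]) (Q : Fin p → ℂ[X]) :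
    quotientForm h1 P Q = ∑ b, ∑ c, cintegral (μ b c) fun t =>
      (P b * (R.adjugate *ᵥ Q) c).eval (t : ℂ) * (R.det.eval (t : ℂ))⁻¹ := rfl

/-- The pairing of the perturbed matrix of measures, as a bilinear form. -/
def geronimusForm : (Fin q → ℂ[X]) →ₗ[ℂ] (Fin p → ℂ[X]) →ₗ[ℂ] ℂ :=
  quotientForm h1 + ∑ i, J.massForm ξ i

theorem geronimusForm_apply (P : Fin q → ℂ[X]) (Q : Fin p → ℂ[X]) :
    geronimusForm h1 J ξ P Q = quotientForm h1 P Q + ∑ i, J.massForm ξ i P Q := by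
  simp [geronimusForm]

variable {ξ}

theorem geronimusPairing_eq
    (hξ : ∀ i j k b, k < J.κ i j → AnalyticAt ℂ (ξ i j k b) (J.x i))
    (P : Fin q → ℂ[X]) (Q : Fin p → ℂ[X]) :
    geronimusPairing μ J ξ P Q = geronimusForm h1 J ξ P Q := by
  rw [geronimusPairing, geronimusForm_apply, quotientForm_apply]
  congr 1
  · refine Finset.sum_congr rfl fun b _ => Finset.sum_congr rfl fun c _ => ?_
    congr 1
    funext t
    simp only [inv_evalDeriv_zero, Matrix.mulVec, dotProduct, eval_mul, eval_finsetSum,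
      Finset.mul_sum, Finset.sum_mul]
    exact Finset.sum_congr rfl fun a _ => by ring
  · exact Finset.sum_congr rfl fun i _ => J.massForm_eq hξ i P Q

/-- The masses vanish on multiples of R, and adj(R) R = det R cancels the weight on Δ, which carries
μ. -/
theorem geronimusForm_mulVec
    (h0 : ∀ b a (S : ℂ[X]), (μ b a).Integrable fun t : ℝ => S.eval (t : ℂ) * 1)
    (hsupp : ∀ b a, (μ b a).variation Δᶜ = 0)
    (hspec : ∀ t ∈ Δ, R.det.eval (t : ℂ) ≠ 0)
    (P : Fin q → ℂ[X]) (Q : Fin p → ℂ[X]) :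
    geronimusForm h1 J ξ P (mulVecMap R Q) =
      functionalForm (fun b a => polyIntegral (μ b a) (fun _ => 1) (h0 b a)) P Q := by
  rw [geronimusForm_apply, mulVecMap_apply,
    Finset.sum_eq_zero fun i _ => J.massForm_mulVec ξ i P Q, add_zero,
    quotientForm_apply, functionalForm_apply]
  refine Finset.sum_congr rfl fun b _ => Finset.sum_congr rfl fun c _ => ?_
  refine cintegral_congr (hsupp b c) fun t ht => ?_
  rw [Matrix.mulVec_mulVec, Matrix.adjugate_mul, Matrix.smul_mulVec, Matrix.one_mulVec]
  have := hspec t ht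
  simp only [Pi.smul_apply, smul_eq_mul, eval_mul, mul_one]
  field_simp

theorem adjugate_mulVec_jordanColumn (u : J.Index) (c : Fin p) :
    (X - C (J.x u.1)) ^ (u.2.2.val + 1) * (R.adjugate *ᵥ J.jordanColumn u) c =
      R.det * J.rightPoly u c := by
  have h : (X - C (J.x u.1)) ^ (u.2.2.val + 1) • J.jordanColumn u = R *ᵥ J.rightPoly u :=
    funext fun a => J.mul_jordanColumn u a
  have h2 := congrFun (congrArg (fun v => R.adjugate *ᵥ v) h) c
  simpa only [Matrix.mulVec_smul, Matrix.mulVec_mulVec, Matrix.adjugate_mul, Matrix.smul_mulVec,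
    Matrix.one_mulVec, Pi.smul_apply, smul_eq_mul] using h2

/-- This is the partial fraction form of v(t) / (t - x_i)^(k+1), written in powers of x_i - t to
match the derivatives of the Cauchy kernel; the change of sign produces -(-1)^l. -/
theorem sum_rightPoly_div (u : J.Index) (c : Fin p) {t : ℂ} (ht : J.x u.1 - t ≠ 0) :
    (J.rightPoly u c).eval t = -(t - J.x u.1) ^ (u.2.2.val + 1) *
      ∑ l ∈ Finset.range (u.2.2.val + 1), (-1) ^ l * J.vR u.1 u.2.1 (u.2.2 - l) c *
        ((J.x u.1 - t) ^ (l + 1))⁻¹ := by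
  rw [CanonicalJordanData.rightPoly, eval_finsetSum, ← Finset.sum_range_reflect, Finset.mul_sum]
  refine Finset.sum_congr rfl fun l hl => ?_
  have hl' : l ≤ u.2.2.val := Nat.lt_succ_iff.1 (Finset.mem_range.1 hl)
  have ht' : t - J.x u.1 ≠ 0 := by
    rw [← neg_sub]
    exact neg_ne_zero.2 ht
  have h1 : (t - J.x u.1) ^ (u.2.2.val + 1) =
      (t - J.x u.1) ^ (u.2.2.val - l) * (t - J.x u.1) ^ (l + 1) := by
    rw [← pow_add]
    congr 1
    omega
  have h2 : (J.x u.1 - t) ^ (l + 1) = -(-1) ^ l * (t - J.x u.1) ^ (l + 1) := by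
    rw [← neg_sub t, neg_pow, pow_succ (-1 : ℂ)]
    ring
  have h3 : ((-1 : ℂ) ^ l) ≠ 0 := pow_ne_zero _ (by norm_num)
  simp only [eval_mul, eval_C, eval_pow, eval_sub, eval_X, Nat.add_sub_cancel]
  rw [h1, h2]
  field_simp

/-- The entries of `𝔻` are, up to the sign, the pairings of `dμ R⁻¹` with the Jordan columns. -/
theorem bbD_eq (hΔ : IsClosed Δ) (hsupp : ∀ b a, (μ b a).variation Δᶜ = 0)
    (hint : ∀ b a (S : ℂ[X]), (μ b a).Integrable fun t : ℝ => S.eval (t : ℂ))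
    (hspec : ∀ t ∈ Δ, R.det.eval (t : ℂ) ≠ 0) (P : Fin q → ℂ[X]) (u : J.Index) :
    bbD μ J P u = -quotientForm h1 P (J.jordanColumn u) := by
  have hx : ∀ t ∈ Δ, J.x u.1 ≠ (t : ℂ) := by
    intro t ht h
    exact hspec t ht (h ▸ (J.det_eq_zero_iff _).2 ⟨u.1, rfl⟩)
  obtain ⟨ε, hε, hdist⟩ := exists_le_norm_sub hΔ hx
  have hcauchy : ∀ l c, iteratedDeriv l (fun z => cauchyD μ P z c) (J.x u.1) =
      ∑ b, (-1) ^ l * l ! * cintegral (μ b c) fun t =>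
        (P b).eval (t : ℂ) * ((J.x u.1 - (t : ℂ)) ^ (l + 1))⁻¹ := by
    intro l c
    simp only [cauchyD]
    rw [iteratedDeriv_fun_sum fun b _ =>
      (analyticAt_cintegral hΔ (hsupp b c) (hint b c (P b)) hx).contDiffAt]
    exact Finset.sum_congr rfl fun b _ =>
      iteratedDeriv_cintegral hΔ (hsupp b c) (hint b c (P b)) hx l
  have hquot : ∀ b c, cintegral (μ b c) (fun t => (P b * (R.adjugate *ᵥ J.jordanColumn u) c).eval
      (t : ℂ) * (R.det.eval (t : ℂ))⁻¹) = -∑ l ∈ Finset.range (u.2.2.val + 1),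
        (-1) ^ l * J.vR u.1 u.2.1 (u.2.2 - l) c * cintegral (μ b c) fun t =>
          (P b).eval (t : ℂ) * ((J.x u.1 - (t : ℂ)) ^ (l + 1))⁻¹ := by
    intro b c
    rw [← Finset.sum_congr rfl fun l _ => cintegral_const_mul _ _, ← cintegral_sum _ fun l _ =>
      (integrable_mul_sub_pow_inv (hsupp b c) (hint b c (P b)) hε hdist (l + 1)).const_mul _,
      ← neg_one_mul, ← cintegral_const_mul]
    refine cintegral_congr (hsupp b c) fun t ht => ?_
    have hxt : J.x u.1 - (t : ℂ) ≠ 0 := sub_ne_zero.2 (hx t ht)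
    have htx : ((t : ℂ) - J.x u.1) ^ (u.2.2.val + 1) ≠ 0 :=
      pow_ne_zero _ (sub_ne_zero.2 (hx t ht).symm)
    have hadj := congrArg (eval (t : ℂ)) (adjugate_mulVec_jordanColumn J u c)
    rw [eval_mul, eval_mul, sum_rightPoly_div J u c hxt] at hadj
    simp only [eval_pow, eval_sub, eval_X, eval_C] at hadj
    have hadj' : ((R.adjugate *ᵥ J.jordanColumn u) c).eval (t : ℂ) = -(R.det.eval (t : ℂ) *
        ∑ l ∈ Finset.range (u.2.2.val + 1), (-1) ^ l * J.vR u.1 u.2.1 (u.2.2 - l) c *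
          ((J.x u.1 - t) ^ (l + 1))⁻¹) := by
      refine mul_left_cancel₀ htx ?_
      rw [hadj]
      ring
    have hdet := hspec t ht
    rw [eval_mul, hadj', mul_neg, neg_mul, neg_one_mul, mul_left_comm, mul_comm (R.det.eval _),
      mul_inv_cancel_right₀ hdet, Finset.mul_sum]
    exact congrArg Neg.neg (Finset.sum_congr rfl fun l _ => by ring)
  rw [quotientForm_apply, bbD]
  simp only [hquot, hcauchy, Finset.mul_sum, Finset.sum_mul, Finset.sum_neg_distrib, neg_neg]
  refine Finset.sum_comm.trans ((Finset.sum_congr rfl fun c _ => ?_).trans Finset.sum_comm)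
  rw [Finset.sum_comm]
  refine Finset.sum_congr rfl fun b _ => Finset.sum_congr rfl fun l _ => ?_
  have h1 : (l ! : ℂ) ≠ 0 := Nat.cast_ne_zero.2 l.factorial_ne_zero
  field_simp

theorem bbD_sub_bbW_eq (hΔ : IsClosed Δ) (hsupp : ∀ b a, (μ b a).variation Δᶜ = 0)
    (hint : ∀ b a (S : ℂ[X]), (μ b a).Integrable fun t : ℝ => S.eval (t : ℂ))
    (hspec : ∀ t ∈ Δ, R.det.eval (t : ℂ) ≠ 0)
    (hξ : ∀ i j k b, k < J.κ i j → AnalyticAt ℂ (ξ i j k b) (J.x i))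
    (P : Fin q → ℂ[X]) (u : J.Index) :
    bbD μ J P u - bbW J ξ P u = -geronimusForm h1 J ξ P (J.jordanColumn u) := by
  rw [bbD_eq h1 J hΔ hsupp hint hspec, J.bbW_eq hξ, geronimusForm_apply,
    Finset.sum_eq_single u.1 (fun i _ hi => J.massForm_jordanColumn_of_ne P u hi) (by simp)]
  ring

/-- The determinants of the pairings with the first step-line monomials do not vanish when the
`τ`-determinants do not. -/
theorem det_ne_zero_of_tau_ne_zero [NeZero p] (hΔ : IsClosed Δ)
    (hsupp : ∀ b a, (μ b a).variation Δᶜ = 0)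
    (hint : ∀ b a (S : ℂ[X]), (μ b a).Integrable fun t : ℝ => S.eval (t : ℂ))
    (hspec : ∀ t ∈ Δ, R.det.eval (t : ℂ) ≠ 0)
    (hξ : ∀ i j k b, k < J.κ i j → AnalyticAt ℂ (ξ i j k b) (J.x i))
    (hcol : ∀ u, StepLT (J.jordanColumn u) J.size) {B : ℕ → Fin q → ℂ[X]} {n : ℕ}
    (hτ : tau μ J ξ B n ≠ 0) :
    (Matrix.of fun j c : Fin J.size =>
      geronimusForm h1 J ξ (B (n + 1 - J.size + j)) (stepMonomial p c)).det ≠ 0 := by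
  intro h0
  refine hτ ?_
  -- Expanding each Jordan column in the first K step-line monomials factors the matrix of τ_n.
  have h : (Matrix.of fun m c : Fin J.size => bbD μ J (B (n + 1 - J.size + m)) (J.enum c) -
      bbW J ξ (B (n + 1 - J.size + m)) (J.enum c)) =
      (Matrix.of fun j c : Fin J.size =>
        geronimusForm h1 J ξ (B (n + 1 - J.size + j)) (stepMonomial p c)) *
      Matrix.of fun k c : Fin J.size => -stepCoeff (J.jordanColumn (J.enum c)) k := by
    ext m c
    rw [Matrix.mul_apply, Matrix.of_apply, bbD_sub_bbW_eq h1 J hΔ hsupp hint hspec hξ,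
      (hcol (J.enum c)).eq_sum, map_sum, ← Finset.sum_neg_distrib]
    refine Finset.sum_congr rfl fun k _ => ?_
    rw [map_smul, smul_eq_mul, Matrix.of_apply, Matrix.of_apply]
    ring
  rw [tau, h, Matrix.det_mul, h0, zero_mul]

end Main

end

end MixedMOP

/-! ### Existence of the perturbed orthogonality -/

theorem mainTheorem4 {p q : ℕ} [NeZero p] [NeZero q] (N r : ℕ) (hN : 0 < N) (hr : r < p)
    (R : Matrix (Fin p) (Fin p) ℂ[X]) (hR : MixedMOP.LeadingCondition N r R)
    -- the matrix of measures, carried by the closed set `Δ`, with finite moments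
    (Δ : Set ℝ) (hΔ : IsClosed Δ)
    (μ : Fin q → Fin p → ComplexMeasure ℝ)
    (hsupp : ∀ b a, (μ b a).variation Δᶜ = 0)
    (hmom : ∀ b a (k : ℕ), (μ b a).Integrable fun t : ℝ => (t : ℂ) ^ k)
    -- no eigenvalue of `R` lies in `Δ`
    (hspec : ∀ t ∈ Δ, R.det.eval (t : ℂ) ≠ 0)
    -- canonical sets of Jordan chains, and the free functions of the perturbation
    (J : MixedMOP.CanonicalJordanData R)
    (ξ : (i : Fin J.M) → Fin (J.s i) → ℕ → Fin q → ℂ → ℂ)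
    (hξ : ∀ i j k b, k < J.κ i j → AnalyticAt ℂ (ξ i j k b) (J.x i))
    -- the orthogonality with respect to the original matrix of measures exists
    (B : ℕ → Fin q → ℂ[X]) (A : ℕ → Fin p → ℂ[X])
    (hBA : MixedMOP.IsBiorthogonal (MixedMOP.measurePairing μ) B A)
    -- the `τ`-determinants do not vanish
    (hτ : ∀ n : ℕ, N * p - r ≤ n + 1 → MixedMOP.tau μ J ξ B n ≠ 0)
    -- the first `N p - r` perturbed vector polynomials exist; as `a` is counted from `0`,
    -- the inequality `l * p + a < n` says that `l ≤ ⌈(n - a) / p⌉ - 1`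
    (hB : ∃ Bc : Fin (N * p - r) → Fin q → ℂ[X], ∀ n : Fin (N * p - r),
      MixedMOP.IsStepMonic (Bc n) n ∧
      ∀ (a : Fin p) (l : ℕ), l * p + (a : ℕ) < (n : ℕ) →
        MixedMOP.geronimusPairing μ J ξ (Bc n) (Pi.single a (X ^ l)) = 0) :
    MixedMOP.OrthogonalityExists (MixedMOP.geronimusPairing μ J ξ) := by
  have hint : ∀ b a (S : ℂ[X]), (μ b a).Integrable fun t : ℝ => S.eval (t : ℂ) := fun b a =>
    MixedMOP.integrable_eval (hmom b a)
  have h0 : ∀ b a (S : ℂ[X]), (μ b a).Integrable fun t : ℝ => S.eval (t : ℂ) * 1 := fun b a S => by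
    simpa only [mul_one] using hint b a S
  have hpos : 0 < N * p - r := by
    have := Nat.mul_le_mul_right p (Nat.succ_le_of_lt hN)
    omega
  have hnat := hR.natDegree_det hN hr
  have hdeg : 0 < R.det.degree := natDegree_pos_iff_degree_pos.1 (hnat ▸ hpos)
  have hsize : J.size = N * p - r := (J.size_eq fun h => by simp [h] at hdeg).trans hnat
  obtain ⟨ε, hε, hbound⟩ := MixedMOP.exists_le_norm_eval hΔ hdeg hspec
  have h1 : ∀ b a (S : ℂ[X]),
      (μ b a).Integrable fun t : ℝ => S.eval (t : ℂ) * (R.det.eval (t : ℂ))⁻¹ := fun b a S =>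
    MixedMOP.integrable_mul_inv (hsupp b a) (hint b a S) hε hbound
  have hpair : MixedMOP.geronimusPairing μ J ξ = fun P Q => MixedMOP.geronimusForm h1 J ξ P Q :=
    funext fun P => funext fun Q => MixedMOP.geronimusPairing_eq h1 J hξ P Q
  have hmeas : MixedMOP.measurePairing μ = fun P Q => MixedMOP.functionalForm
      (fun b a => MixedMOP.polyIntegral (μ b a) (fun _ => 1) (h0 b a)) P Q :=
    funext fun P => funext fun Q => MixedMOP.measurePairing_eq h0 P Q
  rw [hmeas] at hBA
  rw [hpair] at hB ⊢
  refine MixedMOP.orthogonalityExists_of_det_ne_zero (K := J.size) (hsize ▸ hpos) hBA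
    (MixedMOP.mulVecMap R) (fun n => hsize ▸ hR.isStepMonic_mulVec hN hr n)
    (MixedMOP.geronimusForm_mulVec h1 J h0 hsupp hspec) (fun n hn => ?_) (fun n hn => ?_)
  · exact MixedMOP.det_ne_zero_of_tau_ne_zero h1 J hΔ hsupp hint hspec hξ
      (fun u => hsize ▸ J.stepLT_jordanColumn hR hN hr u) (hτ n (hsize ▸ hn))
  · obtain ⟨Bc, hBc⟩ := hB
    obtain ⟨hm, ho⟩ := hBc ⟨n, hsize ▸ hn⟩
    refine ⟨_, hm, fun k hk => ?_⟩
    obtain ⟨l, a, rfl⟩ := MixedMOP.exists_step_index p k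
    rw [MixedMOP.stepMonomial_mul_add]
    exact ho a l hk
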